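/- **Setting.** Let $\mathcal O$ be an integral domain and let $\mathcal T$ be a commutative $\mathcal O$-algebra that is finitely generated and torsion free as an $\mathcal O$-module. Let $X$ be a totally ordered set, whose elements are called primes, and let $\mathbf z=\prod_{x\in X}\mathbf z(x)$, $\mathbf z(x)=x^{n_x}$, $n_x\ge 1$, be a (finite or infinite) formal product, so that $X$ is the set of primes dividing $\mathbf z$. A *stalk* $z\mid_s\mathbf z$ is a factor of $\mathbf z$ prime to $\mathbf z/z$; it is determined by the set of primes dividing it, which may be any subset of $X$, and it is finite if this set is finite. For each prime $x\mid\mathbf z$ let a finite cyclic group $G_{\mathbf z(x)}$ with a generator $\sigma_{\mathbf z(x)}$ be given. For a stalk $z$ put $G_z=\prod_{x\mid z}G_{\mathbf z(x)}$, regarded both as a subgroup and as a quotient of $G=G_{\mathbf z}$. For $z'\mid_s z$ write $g_{z'}$ for the image of $g\in G_z$ in $G_{z'}$. For each prime $x\mid\mathbf z$ let also an element $\mathrm{Fr}_x\in G$ (its component in $G_{\mathbf z(x)}$ plays no role) and polynomials $p(x;t)\in\mathcal T[t]$ and $r_x(t)\in\mathcal O[t]$ be given. For a stalk $z$ let $\mathcal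 A_z$ be the free $\mathcal T$-module on the symbols $[g\,z']$, where $z'$ is a finite stalk of $z$ and $g\in G_{z'}$, with the $G$-action $h\cdot[g\,z']=[h_{z'}g\,z']$. Write $[z']=[1\,z']$ and $N_{\mathbf z(x)}=\sum_{g\in G_{\mathbf z(x)}}g$. Let $\mathcal D_z\subset\mathcal A_z$ be the $\mathcal T[G]$-submodule generated by the elements $$p(x;\mathrm{Fr}_x^{-1})[z']-N_{\mathbf z(x)}[\mathbf z(x)z'],\qquad x\mid z,\quad z'\ \text{a finite stalk of}\ z/\mathbf z(x).$$ The *universal norm distribution* of level $z$ is the $\mathcal T[G]$-module $\mathcal U_z=\mathcal A_z/\mathcal D_z$; put $\mathcal U=\mathcal U_{\mathbf z}$. For stalks $z'\mid_s z$ the inclusion $\mathcal A_{z'}\subset\mathcal A_z$ induces $\mathcal T[G]$-homomorphisms $\mathcal U_{z'}\to\mathcal U_z$. Put $\gamma_x=p(x;\mathrm{Fr}_x^{-1})-r_x(\mathrm{Fr}_x^{-1})\,|G_{\mathbf z(x)}|\in\mathcal T[G]$. Let $I_x\subset\mathcal U$ be the $\mathcal T[G]$-submodule generated by the classes of $$[z\,\mathbf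 z(x)]-g[z\,\mathbf z(x)]\quad\text{and}\quad r_x(\mathrm{Fr}_x^{-1})[z]-g[z\,\mathbf z(x)]$$ for all $g\in G_{\mathbf z(x)}$ and all finite stalks $z$ of $\mathbf z$ with $x\nmid z$. Let $0\ne M\in\mathcal O$, and assume for every prime $x\mid\mathbf z$ that $M$ divides $|G_{\mathbf z(x)}|$ in $\mathcal O$, that $M$ divides $p(x;1)$ in $\mathcal T$, and that multiplication by $\gamma_x$ on $\mathcal U_{\mathbf z/\mathbf z(x)}$ is injective. **Theorem.** Let $x$ be a prime dividing $\mathbf z$. If $a\in\mathcal U$ represents a class in $H^0(G,\mathcal U/M\mathcal U)$, there is a unique element $\frac{(1-\sigma_{\mathbf z(x)})a}{M}$ of $\mathcal U$ whose product with $M$ is $(1-\sigma_{\mathbf z(x)})a$. If $b\in\mathcal U_{\mathbf z/\mathbf z(x)}$ represents a class in $H^0(G,\mathcal U_{\mathbf z/\mathbf z(x)}/M\mathcal U_{\mathbf z/\mathbf z(x)})$, there is a unique element $\frac{\gamma_x b}{M}$ of $\mathcal U_{\mathbf z/\mathbf z(x)}$ whose product with $M$ is $\gamma_x b$. There exists a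 unique group homomorphism $$\varDelta_x: H^0(G,\mathcal U/M\mathcal U)\longrightarrow H^0(G,\mathcal U_{\mathbf z/\mathbf z(x)}/M\mathcal U_{\mathbf z/\mathbf z(x)})$$ such that, for all such $a$ and $b$, $$\frac{(1-\sigma_{\mathbf z(x)})a}{M}\equiv\frac{\gamma_x b}{M}\bmod I_x\iff \varDelta_x(a\bmod M\mathcal U)=b\bmod M\mathcal U_{\mathbf z/\mathbf z(x)},$$ where $\frac{\gamma_x b}{M}$ is mapped to $\mathcal U$ in the congruence. This homomorphism is $\mathcal T[G]$-linear. Moreover, for every finite stalk $z$ of $\mathbf z$ divisible by $x$, $$\varDelta_x H^0(G,\mathcal U_z/M\mathcal U_z)\subset H^0(G,\mathcal U_{z/\mathbf z(x)}/M\mathcal U_{z/\mathbf z(x)}),$$ where these groups stand for their images in $H^0(G,\mathcal U/M\mathcal U)$ and in $H^0(G,\mathcal U_{\mathbf z/\mathbf z(x)}/M\mathcal U_{\mathbf z/\mathbf z(x)})$. -/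

import Mathlib

/-!
The universal norm distribution of a (finite or infinite) formal product `𝐳 = ∏ x ^ n x`.

Conventions.  `X` is the set of primes dividing `𝐳`, and `G x` is the finite group
`G_{𝐳(x)}` attached to the full `x`-part `𝐳(x) = x ^ n x` of `𝐳`.  A stalk of `𝐳` (a factor `z'`
with `gcd(z', 𝐳 / z') = 1`) is determined by the set of primes dividing it, so stalks are subsets
`S` of `X`, finite stalks are finite sets `s`, `𝐳` itself is `Set.univ`, and `𝐳 / 𝐳(x)` is `{x}ᶜ`.
-/

namespace NormDist

open Polynomial

universe u v w

section Modules

variable {X : Type u} (G : X → Type v) [∀ x, CommGroup (G x)]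

/-- The group `G_𝐳`, the direct product of the groups `G_{𝐳(x)}`. -/
abbrev Grp : Type (max u v) := ∀ x, G x

/-- The symbols `[g z']`: a finite stalk `z'` of `𝐳` and an element `g` of the group
`G_{z'} = ∏_{x ∣ z'} G_{𝐳(x)}`. -/
structure Symb where
  /-- the finite stalk, as the set of its primes -/
  stalk : Finset X
  /-- the element of the group of the stalk -/
  elt : ∀ x : stalk, G x

variable {G} in
/-- `G_𝐳` acts on the symbols by `g • [h z'] = [g_{z'} h z']`, with `g_{z'}` the restriction. -/
instance : MulAction (Grp G) (Symb G) where
  smul g a := ⟨a.stalk, fun x => g x * a.elt x⟩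
  one_smul a := by
    change (⟨a.stalk, fun x => (1 : Grp G) x * a.elt x⟩ : Symb G) = a
    simp
  mul_smul g h a := by
    change (⟨a.stalk, fun x => (g * h) x * a.elt x⟩ : Symb G) =
      ⟨a.stalk, fun x => g x * (h x * a.elt x)⟩
    simp [mul_assoc]

variable (T : Type w) [CommRing T]

/-- The group ring `𝒯[G_𝐳]`. -/
abbrev GrpRing : Type (max u v w) := MonoidAlgebra T (Grp G)

/-- The action of `G_𝐳` on the free `𝒯`-module on the symbols `[g z']`. -/
noncomputable def symbRep : Representation T (Grp G) (Symb G →₀ T) where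
  toFun g := Finsupp.lmapDomain T T (g • ·)
  map_one' := by ext; simp
  map_mul' g h := by ext; simp [mul_smul]

/-- The module `𝒜_𝐳`: the free `𝒯`-module on the symbols `[g z']`. -/
def Free : Type (max u v w) := Symb G →₀ T

noncomputable instance : AddCommGroup (Free G T) :=
  inferInstanceAs (AddCommGroup (Symb G →₀ T))

/-- `𝒜_𝐳` is a `𝒯[G_𝐳]`-module through the action of `G_𝐳` on the symbols. -/
noncomputable instance : Module (GrpRing G T) (Free G T) :=
  Module.compHom (Symb G →₀ T) (symbRep G T).asAlgebraHom.toRingHom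

/-- The element `t [g z']` of `𝒜_𝐳`. -/
noncomputable def single (a : Symb G) (t : T) : Free G T :=
  (Finsupp.single a t : Symb G →₀ T)

/-- The element `[z']` of `𝒜_𝐳`, for a finite stalk `z'`. -/
noncomputable def base (s : Finset X) : Free G T :=
  single G T ⟨s, 1⟩ 1

/-- The submodule `𝒜_z` of `𝒜_𝐳`, for a stalk `z` of `𝐳`: it is spanned by all `[g z']` with
`z'` a finite stalk of `z`. -/
noncomputable def freeSub (S : Set X) : Submodule (GrpRing G T) (Free G T) :=
  Submodule.span _ {a | ∃ s : Finset X, (s : Set X) ⊆ S ∧ a = base G T s}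

variable {G T}

/-- The group element `g`, seen in the group ring. -/
noncomputable abbrev grp (g : Grp G) : GrpRing G T := MonoidAlgebra.of T (Grp G) g

theorem single_smul_single (t' : T) (g : Grp G) (a : Symb G) (t : T) :
    (MonoidAlgebra.single g t' : GrpRing G T) • single G T a t = single G T (g • a) (t' * t) := by
  change (symbRep G T).asAlgebraHom (MonoidAlgebra.single g t') (Finsupp.single a t) =
    Finsupp.single (g • a) (t' * t)
  simp [Representation.asAlgebraHom_single, symbRep]

theorem freeSub_mono {S S' : Set X} (h : S ⊆ S') : freeSub G T S ≤ freeSub G T S' :=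
  Submodule.span_mono fun _ ⟨s, hs, ha⟩ => ⟨s, hs.trans h, ha⟩

/-- The invariants `H⁰(G_𝐳, V)` of a `𝒯[G_𝐳]`-module `V`. -/
noncomputable def H0 (V : Type*) [AddCommGroup V] [Module (GrpRing G T) V] :
    Submodule (GrpRing G T) V where
  carrier := {c | ∀ g : Grp G, (grp g : GrpRing G T) • c = c}
  add_mem' ha hb g := by rw [smul_add, ha g, hb g]
  zero_mem' g := smul_zero _
  smul_mem' r c hc g := by rw [smul_comm, hc g]

/-- The map on invariants induced by a homomorphism of `𝒯[G_𝐳]`-modules. -/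
noncomputable def H0map {V W : Type*} [AddCommGroup V] [Module (GrpRing G T) V]
    [AddCommGroup W] [Module (GrpRing G T) W] (f : V →ₗ[GrpRing G T] W) :
    H0 (G := G) (T := T) V →ₗ[GrpRing G T] H0 (G := G) (T := T) W :=
  f.restrict fun c hc g => by rw [← map_smul, hc g]

end Modules

section Distribution

variable {X : Type u} [DecidableEq X] {G : X → Type v} [∀ x, CommGroup (G x)]
  [∀ x, Fintype (G x)] {T : Type w} [CommRing T]

/-- The norm element `N_{𝐳(x)}`, the sum of all elements of `G_{𝐳(x)} ⊆ G_𝐳`. -/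
noncomputable def normElt (x : X) : GrpRing G T :=
  ∑ g : G x, grp (Pi.mulSingle x g)

variable (p : X → T[X]) (Fr : X → Grp G)

/-- The element `λ_{𝐳(x)}[z'] = p(x; Fr_x⁻¹)[z'] - N_{𝐳(x)}[𝐳(x) z']`, for `x ∤ z'`. -/
noncomputable def lam (x : X) (s : Finset X) : Free G T :=
  aeval (grp (Fr x)⁻¹ : GrpRing G T) (p x) • base G T s -
    (normElt x : GrpRing G T) • base G T (insert x s)

/-- The submodule `𝒟_z` of `𝒜_z`: it is generated by the images `λ_{𝐳(x)}(𝒜_{z/𝐳(x)})`, `x ∣ z`.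
As `λ_{𝐳(x)}` is `𝒯[G_𝐳]`-linear, its image is spanned by the elements `λ_{𝐳(x)}[z']`. -/
noncomputable def relSub (S : Set X) : Submodule (GrpRing G T) (Free G T) :=
  Submodule.span _ {a | ∃ x ∈ S, ∃ s : Finset X, (s : Set X) ⊆ S \ {x} ∧ a = lam p Fr x s}

/-- The universal norm distribution `𝒰_z = 𝒜_z / 𝒟_z` of level `z`, for a stalk `z` of `𝐳`. -/
abbrev Univ (S : Set X) : Type (max u v w) :=
  freeSub G T S ⧸ (relSub p Fr S).submoduleOf (freeSub G T S)

/-- The class of `[z']` in `𝒰_z`, for a finite stalk `z'` of `z`. -/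
noncomputable def symb (S : Set X) (s : Finset X) (hs : (s : Set X) ⊆ S) : Univ p Fr S :=
  Submodule.Quotient.mk ⟨base G T s, Submodule.subset_span ⟨s, hs, rfl⟩⟩

theorem relSub_mono {S S' : Set X} (h : S ⊆ S') : relSub p Fr S ≤ relSub p Fr S' :=
  Submodule.span_mono fun _ ⟨x, hx, s, hs, ha⟩ =>
    ⟨x, h hx, s, hs.trans (Set.sdiff_subset_sdiff_left h), ha⟩

/-- The map `𝒰_{z'} → 𝒰_z` induced by the inclusion `𝒜_{z'} ⊆ 𝒜_z`, for stalks `z' ∣ z`. -/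
noncomputable def incl {S S' : Set X} (h : S ⊆ S') :
    Univ p Fr S →ₗ[GrpRing G T] Univ p Fr S' :=
  Submodule.mapQ _ _ (Submodule.inclusion (freeSub_mono h)) fun _ ha => relSub_mono p Fr h ha

variable {O : Type*} [CommRing O] [Algebra O T]

/-- The element `γ_{𝐳(x)} = p(x; Fr_x⁻¹) - r_x(Fr_x⁻¹) |G_{𝐳(x)}|` of `𝒯[G_𝐳]`. -/
noncomputable def gam (r : X → O[X]) (x : X) : GrpRing G T :=
  aeval (grp (Fr x)⁻¹ : GrpRing G T) (p x) -
    aeval (grp (Fr x)⁻¹ : GrpRing G T) (r x) * (Fintype.card (G x) : GrpRing G T)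

/-- The `𝒯[G_𝐳]`-submodule `I_x` of `𝒰_𝐳`, generated by the classes of
`[z 𝐳(x)] - g[z 𝐳(x)]` and `r_x(Fr_x⁻¹)[z] - g[z 𝐳(x)]`, for `g ∈ G_{𝐳(x)}` and `z` a finite
stalk of `𝐳` with `x ∤ z`. -/
noncomputable def idl (r : X → O[X]) (x : X) :
    Submodule (GrpRing G T) (Univ p Fr (Set.univ : Set X)) :=
  Submodule.span _
    {a | ∃ (s : Finset X) (g : G x), x ∉ s ∧
      (a = symb p Fr Set.univ (insert x s) (Set.subset_univ _) -
          (grp (Pi.mulSingle x g) : GrpRing G T) •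
            symb p Fr Set.univ (insert x s) (Set.subset_univ _) ∨
        a = aeval (grp (Fr x)⁻¹ : GrpRing G T) (r x) •
            symb p Fr Set.univ s (Set.subset_univ _) -
          (grp (Pi.mulSingle x g) : GrpRing G T) •
            symb p Fr Set.univ (insert x s) (Set.subset_univ _))}

/-- An element `M` of `𝒪`, seen in the group ring. -/
noncomputable abbrev scal (M : O) : GrpRing G T := algebraMap O (GrpRing G T) M

/-- The quotient `𝒰_z / M 𝒰_z`. -/
abbrev UnivMod (M : O) (S : Set X) : Type (max u v w) :=
  QuotSMulTop (scal M : GrpRing G T) (Univ p Fr S)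

/-- Reduction `𝒰_z → 𝒰_z / M 𝒰_z`. -/
noncomputable def red (M : O) (S : Set X) :
    Univ p Fr S →ₗ[GrpRing G T] UnivMod p Fr M S :=
  Submodule.mkQ _

/-- The group `H⁰(G_𝐳, 𝒰_z / M 𝒰_z)`. -/
noncomputable abbrev H0Mod (M : O) (S : Set X) : Submodule (GrpRing G T) (UnivMod p Fr M S) :=
  H0 (UnivMod p Fr M S)

/-- The map `H⁰(G_𝐳, 𝒰_{z'} / M 𝒰_{z'}) → H⁰(G_𝐳, 𝒰_z / M 𝒰_z)` induced by
`𝒜_{z'} ⊆ 𝒜_z`, for stalks `z' ∣ z`. -/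
noncomputable def H0incl (M : O) {S S' : Set X} (h : S ⊆ S') :
    H0Mod p Fr M S →ₗ[GrpRing G T] H0Mod p Fr M S' :=
  H0map (QuotSMulTop.map (scal M : GrpRing G T) (incl p Fr h))

/-- The congruence `(1 - σ_{𝐳(x)}) a / M ≡ γ_{𝐳(x)} b / M mod I_x`, where `𝒰_{𝐳/𝐳(x)}` is mapped
to `𝒰_𝐳`: here `q` is the quotient `(1 - σ_{𝐳(x)}) a / M` in `𝒰_𝐳` and `q'` is the quotient
`γ_{𝐳(x)} b / M` in `𝒰_{𝐳/𝐳(x)}`. -/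
def Cong (r : X → O[X]) (M : O) (σ : ∀ x, G x) (x : X)
    (a : Univ p Fr (Set.univ : Set X)) (b : Univ p Fr ({x}ᶜ : Set X)) : Prop :=
  ∃ (q : Univ p Fr (Set.univ : Set X)) (q' : Univ p Fr ({x}ᶜ : Set X)),
    (scal M : GrpRing G T) • q = (1 - grp (Pi.mulSingle x (σ x)) : GrpRing G T) • a ∧
    (scal M : GrpRing G T) • q' = gam p Fr r x • b ∧
    q - incl p Fr (Set.subset_univ _) q' ∈ idl p Fr r x

/-- The property that characterizes the map `Δ_x`: for all `a ∈ 𝒰_𝐳` and `b ∈ 𝒰_{𝐳/𝐳(x)}` that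
represent invariant classes modulo `M`, the congruence holds if and only if `Δ_x` maps the class
of `a` to the class of `b`. -/
def IsDelta (r : X → O[X]) (M : O) (σ : ∀ x, G x) (x : X)
    (Δ : H0Mod p Fr M (Set.univ : Set X) → H0Mod p Fr M ({x}ᶜ : Set X)) : Prop :=
  ∀ (a : Univ p Fr (Set.univ : Set X)) (ha : red p Fr M _ a ∈ H0Mod p Fr M Set.univ)
    (b : Univ p Fr ({x}ᶜ : Set X)) (hb : red p Fr M _ b ∈ H0Mod p Fr M {x}ᶜ),
    Cong p Fr r M σ x a b ↔ Δ ⟨red p Fr M _ a, ha⟩ = ⟨red p Fr M _ b, hb⟩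

end Distribution

end NormDist

/-!
The proof has two parts: the structure of the modules `𝒰_z`, and a computation of the quotient
of `𝒰_𝐳` by `I_x`.

Call a symbol `[g z']` reduced if no component of `g` at a prime of `z'` is trivial.  The relation
`p(x; Fr_x⁻¹)[z'] = N_{𝐳(x)}[𝐳(x) z']` rewrites a symbol with `g_x = 1` through symbols that are
closer to being reduced, so the reduced symbols of level `z` generate `𝒰_z` over `𝒯`
(`freeSub_le_reduced_sup`).  They are also independent
(`eq_zero_of_mem_reduced_of_mem_relFor`): impose the relations of one prime after the other.  Before
those of `x` are imposed, symbols with `g_x = 1` are still among the basis elements, and since the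
maps `λ_{𝐳(x)}` commute (`lamHom_mem_relFor`), the relations of `x` amount to the elements
`λ_{𝐳(x)} b` with `b` reduced and prime to `x`.  Such an element involves the symbols `[g 𝐳(x) z']`
with `g_x = 1` with the coefficients of `-b`, so it eliminates exactly these symbols.  As the
reduced symbols of level `z` are among those of level `𝐳`, multiplication by `M ≠ 0` is injective
on `𝒰_z` (`scal_smul_injective`) and the maps `𝒰_{z'} → 𝒰_z` are injective (`incl_injective`).

Killing `I_x` makes `[𝐳(x) z']` equal to `r_x(Fr_x⁻¹)[z']`, and the relation of `x` becomes
`γ_x [z'] = 0`.  Hence `I_x` is the kernel of a homomorphism `special` from `𝒰_𝐳` to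
`𝒰_{𝐳/𝐳(x)} / γ_x 𝒰_{𝐳/𝐳(x)}` (`mem_idl_iff`), on whose target `G_{𝐳(x)}` acts trivially.  If
`a` is invariant modulo `M`, write `(1 - σ) a = M q` and represent the image of `q` by `q'`.  The
image of `M q = (1 - σ) a` is zero, so `M q' = γ_x b` for some `b`, unique because `γ_x` is
injective; changing `q'` by a multiple of `γ_x` changes `b` by a multiple of `M`.  This is the map
`Δ_x` (`exists_derivative`, `exists_isDelta`).  The same construction works at every level `z` and
is natural in `z` (`special_naturality`), which gives the statement on finite stalks.
-/

set_option linter.unusedSectionVars false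

namespace NormDist

open Polynomial

/-! ### Symbols and the free module -/

section Basic

variable {X : Type*} [DecidableEq X] {G : X → Type*} [∀ x, CommGroup (G x)]
  {T : Type*} [CommRing T]

/-- The components of a symbol, extended by `1` to an element of the whole group. -/
def Symb.val (a : Symb G) : Grp G := fun x => if h : x ∈ a.stalk then a.elt ⟨x, h⟩ else 1

/-- The symbol `[g_{z'} z']` of a finite stalk `z'`, for an element `g` of the whole group. -/
def Symb.ofGrp (s : Finset X) (g : Grp G) : Symb G := ⟨s, fun x => g x⟩

@[simp] theorem Symb.stalk_ofGrp (s : Finset X) (g : Grp G) : (Symb.ofGrp s g).stalk = s := rfl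

theorem Symb.val_of_mem {a : Symb G} {x : X} (h : x ∈ a.stalk) : a.val x = a.elt ⟨x, h⟩ :=
  dif_pos h

theorem Symb.val_of_notMem {a : Symb G} {x : X} (h : x ∉ a.stalk) : a.val x = 1 :=
  dif_neg h

theorem Symb.val_ofGrp (s : Finset X) (g : Grp G) (x : X) :
    (Symb.ofGrp s g).val x = if x ∈ s then g x else 1 := by
  by_cases h : x ∈ s
  · rw [if_pos h, Symb.val_of_mem (a := Symb.ofGrp s g) h]; rfl
  · rw [if_neg h, Symb.val_of_notMem (a := Symb.ofGrp s g) h]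

@[simp] theorem Symb.ofGrp_val (a : Symb G) : Symb.ofGrp a.stalk a.val = a := by
  obtain ⟨s, e⟩ := a
  unfold Symb.ofGrp
  congr 1
  funext x
  exact dif_pos x.2

theorem Symb.ofGrp_congr {s : Finset X} {g h : Grp G} (H : ∀ x ∈ s, g x = h x) :
    Symb.ofGrp s g = Symb.ofGrp s h := by
  unfold Symb.ofGrp
  congr 1
  funext x
  exact H x x.2

theorem single_ofGrp (s : Finset X) (g : Grp G) (t : T) :
    single G T (Symb.ofGrp s g) t = (MonoidAlgebra.single g t : GrpRing G T) • base G T s := by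
  rw [base, single_smul_single, mul_one]
  congr 1
  change _ = (⟨s, fun x => g x * 1⟩ : Symb G)
  simp only [mul_one]
  rfl

theorem single_eq_smul_base (a : Symb G) (t : T) :
    single G T a t = (MonoidAlgebra.single a.val t : GrpRing G T) • base G T a.stalk := by
  rw [← single_ofGrp, Symb.ofGrp_val]

theorem single_smul_base_congr {s : Finset X} {g h : Grp G} (H : ∀ x ∈ s, g x = h x) (t : T) :
    (MonoidAlgebra.single g t : GrpRing G T) • base G T s =
      (MonoidAlgebra.single h t : GrpRing G T) • base G T s := by
  rw [← single_ofGrp, ← single_ofGrp, Symb.ofGrp_congr H]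

theorem grp_smul_base {s : Finset X} {g : Grp G} (H : ∀ x ∈ s, g x = 1) :
    (grp g : GrpRing G T) • base G T s = base G T s := by
  have := single_smul_base_congr (T := T) (s := s) (g := g) (h := 1) H 1
  rw [← MonoidAlgebra.one_def, one_smul] at this
  exact this

theorem single_zero (a : Symb G) : single G T a 0 = 0 := Finsupp.single_zero a

theorem single_add (a : Symb G) (t t' : T) :
    single G T a (t + t') = single G T a t + single G T a t' := Finsupp.single_add a t t'

theorem Free.induction {P : Free G T → Prop} (a : Free G T) (zero : P 0)
    (add : ∀ a b, P a → P b → P (a + b)) (single : ∀ a t, P (single G T a t)) : P a :=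
  Finsupp.induction_linear (motive := P) a zero add single

/-- The homomorphism out of `𝒜_𝐳` that sends `[z']` to `v z'`.  It exists as soon as `v z'` is
fixed by the group elements that are trivial on `z'`. -/
noncomputable def lift {V : Type*} [AddCommGroup V] [Module (GrpRing G T) V] (v : Finset X → V)
    (hv : ∀ s (g : Grp G), (∀ x ∈ s, g x = 1) → (grp g : GrpRing G T) • v s = v s) :
    Free G T →ₗ[GrpRing G T] V :=
  let f : Free G T →+ V := Finsupp.liftAddHom fun a : Symb G =>
    { toFun := fun t : T => (MonoidAlgebra.single a.val t : GrpRing G T) • v a.stalk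
      map_zero' := by rw [MonoidAlgebra.single_zero, zero_smul]
      map_add' := fun t t' => by rw [MonoidAlgebra.single_add, add_smul] }
  have hf : ∀ a t, f (single G T a t) =
      (MonoidAlgebra.single a.val t : GrpRing G T) • v a.stalk := fun a t =>
    Finsupp.liftAddHom_apply_single _ _ _
  { f with
    map_smul' := fun r a => by
      change f (r • a) = r • f a
      induction a using Free.induction with
      | zero => simp
      | add a b ha hb => rw [smul_add, map_add, map_add, smul_add, ha, hb]
      | single a t =>
        induction r using MonoidAlgebra.induction_linear with
        | zero => simp
        | add r r' h h' => rw [add_smul, map_add, add_smul, h, h']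
        | single g t' =>
          rw [single_smul_single, hf, hf, smul_smul, MonoidAlgebra.single_mul_single]
          -- the components of `g • a` and those of `g` times `a` differ off the stalk of `a` only
          have h1 : g * a.val = (g • a).val * (g * a.val * (g • a).val⁻¹) := by
            simp
          have h2 : ∀ x ∈ a.stalk, (g * a.val * (g • a).val⁻¹) x = 1 := fun x hx => by
            have : (g • a).val x = g x * a.val x := by
              rw [Symb.val_of_mem (a := g • a) hx, Symb.val_of_mem hx]; rfl
            simp [this]
          rw [h1, ← mul_one (t' * t), ← MonoidAlgebra.single_mul_single, ← smul_smul]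
          congr 1
          · rw [mul_one]
          · exact (hv _ _ h2).symm }

@[simp] theorem lift_base {V : Type*} [AddCommGroup V] [Module (GrpRing G T) V] (v : Finset X → V)
    (hv : ∀ s (g : Grp G), (∀ x ∈ s, g x = 1) → (grp g : GrpRing G T) • v s = v s)
    (s : Finset X) : lift v hv (base G T s) = v s := by
  have : lift v hv (base G T s) =
      (MonoidAlgebra.single (Symb.ofGrp s (1 : Grp G)).val 1 : GrpRing G T) • v s :=
    Finsupp.liftAddHom_apply_single _ _ _
  rw [this]
  refine hv s _ fun x hx => ?_
  rw [Symb.val_ofGrp, if_pos hx]; rfl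

theorem single_mem_freeSub {S : Set X} {a : Symb G} (h : (a.stalk : Set X) ⊆ S) (t : T) :
    single G T a t ∈ freeSub G T S := by
  rw [single_eq_smul_base]
  exact Submodule.smul_mem _ _ (Submodule.subset_span ⟨_, h, rfl⟩)

theorem base_mem_freeSub {S : Set X} {s : Finset X} (h : (s : Set X) ⊆ S) :
    base G T s ∈ freeSub G T S := Submodule.subset_span ⟨s, h, rfl⟩

/-- The additive group generated by the elements `t [g z']` for the symbols `[g z']` in a set. -/
noncomputable def symbSpan (T : Type*) [CommRing T] (A : Set (Symb G)) : AddSubgroup (Free G T) :=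
  AddSubgroup.closure {a | ∃ b ∈ A, ∃ t, a = single G T b t}

theorem single_mem_symbSpan {A : Set (Symb G)} {a : Symb G} (h : a ∈ A) (t : T) :
    single G T a t ∈ symbSpan T A := AddSubgroup.subset_closure ⟨a, h, t, rfl⟩

theorem symbSpan_le {A : Set (Symb G)} {K : AddSubgroup (Free G T)}
    (h : ∀ a ∈ A, ∀ t, single G T a t ∈ K) : symbSpan T A ≤ K :=
  (AddSubgroup.closure_le K).2 fun _ ⟨b, hb, t, e⟩ => e ▸ h b hb t

theorem map_mem_of_mem_symbSpan {W : Type*} [AddCommGroup W] (f : Free G T →+ W)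
    (K : AddSubgroup W) {A : Set (Symb G)} (h : ∀ a ∈ A, ∀ t, f (single G T a t) ∈ K)
    {a : Free G T} (ha : a ∈ symbSpan T A) : f a ∈ K :=
  (symbSpan_le (K := K.comap f) h : symbSpan T A ≤ K.comap f) ha

theorem symbSpan_mono {A B : Set (Symb G)} (h : A ⊆ B) : symbSpan T A ≤ symbSpan T B :=
  symbSpan_le fun _ ha t => single_mem_symbSpan (h ha) t

theorem freeSub_le_symbSpan (S : Set X) :
    (freeSub G T S).toAddSubgroup ≤ symbSpan T {a : Symb G | (a.stalk : Set X) ⊆ S} := by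
  have key : ∀ (r : GrpRing G T) (a : Free G T),
      a ∈ symbSpan T {a : Symb G | (a.stalk : Set X) ⊆ S} →
      r • a ∈ symbSpan T {a : Symb G | (a.stalk : Set X) ⊆ S} := by
    intro r a ha
    induction r using MonoidAlgebra.induction_linear with
    | zero => rw [zero_smul]; exact zero_mem _
    | add r r' h h' => rw [add_smul]; exact add_mem h h'
    | single g t =>
      refine map_mem_of_mem_symbSpan
        (DistribSMul.toAddMonoidHom (Free G T) (MonoidAlgebra.single g t : GrpRing G T)) _ ?_ ha
      intro b hb t'
      change (MonoidAlgebra.single g t : GrpRing G T) • single G T b t' ∈ _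
      rw [single_smul_single]
      exact single_mem_symbSpan (show (((g • b).stalk : Finset X) : Set X) ⊆ S from hb) _
  intro a ha
  refine Submodule.span_induction (p := fun a _ => a ∈ symbSpan T _) ?_ (zero_mem _)
    (fun _ _ _ _ h h' => add_mem h h') (fun r a _ h => key r a h) ha
  rintro _ ⟨s, hs, rfl⟩
  exact single_mem_symbSpan hs 1

variable {O : Type*} [CommRing O] [Algebra O T]

theorem scal_eq (M : O) :
    (scal M : GrpRing G T) = MonoidAlgebra.single 1 (algebraMap O T M) := rfl

theorem scal_smul_symbSpan (M : O) {A : Set (Symb G)} {a : Free G T} (ha : a ∈ symbSpan T A) :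
    (scal M : GrpRing G T) • a ∈ symbSpan T A := by
  refine map_mem_of_mem_symbSpan
    (DistribSMul.toAddMonoidHom (Free G T) (scal M : GrpRing G T)) _ ?_ ha
  intro b hb t'
  change (scal M : GrpRing G T) • single G T b t' ∈ _
  rw [scal_eq, single_smul_single, one_smul]
  exact single_mem_symbSpan hb _

theorem scal_smul_apply (M : O) (a : Free G T) (b : Symb G) :
    (show Symb G →₀ T from (scal M : GrpRing G T) • a) b = M • (show Symb G →₀ T from a) b := by
  induction a using Free.induction with
  | zero => rw [smul_zero]; exact (smul_zero M).symm
  | add a a' h h' =>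
    rw [smul_add]
    exact (congrArg₂ (· + ·) h h').trans (smul_add M _ _).symm
  | single a t =>
    classical
    rw [scal_eq, single_smul_single, one_smul]
    change (Finsupp.single a (algebraMap O T M * t)) b = M • (Finsupp.single a t) b
    rw [← Algebra.smul_def, ← Finsupp.smul_single, Finsupp.smul_apply]

theorem eq_zero_of_scal_smul_free [IsDomain O] [Module.IsTorsionFree O T] {M : O} (hM : M ≠ 0)
    {a : Free G T} (h : (scal M : GrpRing G T) • a = 0) : a = 0 := by
  refine Finsupp.ext (f := (show Symb G →₀ T from a)) (g := 0) fun b => ?_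
  have := scal_smul_apply M a b
  rw [h] at this
  exact (smul_eq_zero_iff_right hM).1 this.symm

end Basic

/-! ### Reduced symbols and the structure of `𝒰_z` -/

section Structure

variable {X : Type*} [DecidableEq X] {G : X → Type*} [∀ x, CommGroup (G x)]
  [∀ x, Fintype (G x)] {T : Type*} [CommRing T]

theorem grp_one : (grp 1 : GrpRing G T) = 1 := map_one _

theorem grp_mul (g h : Grp G) : (grp (g * h) : GrpRing G T) = grp g * grp h := map_mul _ g h

theorem normElt_mul_grp (x : X) (h : G x) :
    (normElt x : GrpRing G T) * grp (Pi.mulSingle x h) = normElt x := by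
  unfold normElt
  rw [Finset.sum_mul]
  simp_rw [← grp_mul, ← Pi.mulSingle_mul]
  exact Fintype.sum_equiv (Equiv.mulRight h) _ _ fun _ => rfl

theorem normElt_smul_base {x : X} {s : Finset X} (hx : x ∉ s) :
    (normElt x : GrpRing G T) • base G T s = (Fintype.card (G x) : GrpRing G T) • base G T s := by
  unfold normElt
  have h : ∀ g ∈ (Finset.univ : Finset (G x)),
      (grp (Pi.mulSingle x g) : GrpRing G T) • base G T s = base G T s := fun g _ =>
    grp_smul_base fun y hy => Pi.mulSingle_eq_of_ne (ne_of_mem_of_not_mem hy hx) _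
  rw [Finset.sum_smul, Finset.sum_congr rfl h, Finset.sum_const, Finset.card_univ,
    Nat.cast_smul_eq_nsmul]

theorem single_smul_normElt_smul_base (x : X) (s : Finset X) (g : Grp G) (t : T) :
    (MonoidAlgebra.single g t : GrpRing G T) • (normElt x : GrpRing G T) • base G T s =
      ∑ h : G x, single G T (Symb.ofGrp s (g * Pi.mulSingle x h)) t := by
  unfold normElt
  rw [Finset.sum_smul, Finset.smul_sum]
  refine Finset.sum_congr rfl fun h _ => ?_
  rw [single_ofGrp, smul_smul]
  change (MonoidAlgebra.single g t * MonoidAlgebra.single (Pi.mulSingle x h) 1 :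
    GrpRing G T) • _ = _
  rw [MonoidAlgebra.single_mul_single, mul_one]

variable (G T) in
/-- The `𝒯[G_𝐳]`-linear map `[z'] ↦ N_{𝐳(x)}[𝐳(x) z']` (and `[z'] ↦ N_{𝐳(x)}[z']` if `x ∣ z'`). -/
noncomputable def normHom (x : X) : Free G T →ₗ[GrpRing G T] Free G T :=
  lift (fun s => (normElt x : GrpRing G T) • base G T (insert x s)) fun s g hg => by
    -- on `𝐳(x) z'` the element `g` acts through its `x`-component, which the norm absorbs
    have h1 : (grp g : GrpRing G T) • base G T (insert x s) =
        (grp (Pi.mulSingle x (g x)) : GrpRing G T) • base G T (insert x s) := by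
      refine single_smul_base_congr (fun y hy => ?_) 1
      by_cases hyx : y = x
      · subst hyx; simp
      · rw [Pi.mulSingle_eq_of_ne hyx, hg y (Finset.mem_of_mem_insert_of_ne hy hyx)]
    rw [smul_comm, h1, smul_smul, normElt_mul_grp]

@[simp] theorem normHom_base (x : X) (s : Finset X) :
    normHom G T x (base G T s) = (normElt x : GrpRing G T) • base G T (insert x s) :=
  lift_base _ _ _

variable (p : X → T[X]) (Fr : X → Grp G)

/-- The `𝒯[G_𝐳]`-linear map `λ_{𝐳(x)}`, extended to all of `𝒜_𝐳`. -/
noncomputable def lamHom (x : X) : Free G T →ₗ[GrpRing G T] Free G T :=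
  (aeval (grp (Fr x)⁻¹ : GrpRing G T) (p x)) • LinearMap.id - normHom G T x

theorem lamHom_apply (x : X) (a : Free G T) :
    lamHom p Fr x a = aeval (grp (Fr x)⁻¹ : GrpRing G T) (p x) • a - normHom G T x a := rfl

@[simp] theorem lamHom_base (x : X) (s : Finset X) :
    lamHom p Fr x (base G T s) = lam p Fr x s := by
  rw [lamHom_apply, normHom_base, lam]

/-- The submodule of `𝒟_z` generated by the relations of the primes in `F` only. -/
noncomputable def relFor (F S : Set X) : Submodule (GrpRing G T) (Free G T) :=
  Submodule.span _ {a | ∃ x ∈ F, x ∈ S ∧ ∃ s : Finset X, (s : Set X) ⊆ S \ {x} ∧ a = lam p Fr x s}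

theorem relFor_mono {F F' S S' : Set X} (hF : F ⊆ F') (hS : S ⊆ S') :
    relFor p Fr F S ≤ relFor p Fr F' S' :=
  Submodule.span_mono fun _ ⟨x, hx, hx', s, hs, ha⟩ =>
    ⟨x, hF hx, hS hx', s, hs.trans (Set.sdiff_subset_sdiff_left hS), ha⟩

theorem relFor_univ (S : Set X) : relFor p Fr Set.univ S = relSub p Fr S := by
  simp [relFor, relSub]

variable (T) in
/-- The additive group generated by the elements `t [g z']` with `z'` a finite stalk of `z` and
`g_y ≠ 1` for all primes `y ∣ z'` in `F`. -/
noncomputable def reduced (F S : Set X) : AddSubgroup (Free G T) :=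
  symbSpan T {a : Symb G | (a.stalk : Set X) ⊆ S ∧ ∀ y ∈ F, y ∈ a.stalk → a.val y ≠ 1}

theorem reduced_mono {F F' S S' : Set X} (hF : F' ⊆ F) (hS : S ⊆ S') :
    reduced (G := G) T F S ≤ reduced T F' S' :=
  symbSpan_mono fun _ h => ⟨h.1.trans hS, fun y hy => h.2 y (hF hy)⟩

/-- The relation `λ_{𝐳(x)}` eliminates the symbols `[g z']` with `x ∣ z'` and `g_x = 1`: it
rewrites them through symbols of smaller stalks and symbols with fewer trivial components. -/
theorem freeSub_le_reduced_sup (F S : Set X) :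
    (freeSub G T S).toAddSubgroup ≤ reduced T F S ⊔ (relFor p Fr F S).toAddSubgroup := by
  classical
  set K := reduced T F S ⊔ (relFor p Fr F S).toAddSubgroup with hK
  have key : ∀ n m : ℕ, ∀ a : Symb G, (a.stalk : Set X) ⊆ S → a.stalk.card = n →
      (a.stalk.filter fun y => y ∈ F ∧ a.val y = 1).card = m → ∀ t, single G T a t ∈ K := by
    intro n
    induction n using Nat.strong_induction_on with
    | _ n ihn =>
    intro m
    induction m using Nat.strong_induction_on with
    | _ m ihm =>
    intro a ha hn hm t
    by_cases hred : ∀ y ∈ F, y ∈ a.stalk → a.val y ≠ 1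
    · have hmem : single G T a t ∈ reduced T F S :=
        AddSubgroup.subset_closure ⟨a, ⟨ha, hred⟩, t, rfl⟩
      exact AddSubgroup.mem_sup_left hmem
    push Not at hred
    obtain ⟨x, hxF, hxa, hx1⟩ := hred
    have hsub : ((a.stalk.erase x : Finset X) : Set X) ⊆ S :=
      (Finset.coe_subset.2 (Finset.erase_subset _ _)).trans ha
    have hsmall : ∀ b ∈ freeSub G T ((a.stalk.erase x : Finset X) : Set X), b ∈ K := by
      intro b hb
      refine (symbSpan_le fun c hc t' => ?_ : symbSpan T _ ≤ K) (freeSub_le_symbSpan _ hb)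
      have hc' : c.stalk ⊆ a.stalk.erase x := Finset.coe_subset.1 hc
      refine ihn c.stalk.card ?_ _ c (hc.trans hsub) rfl rfl t'
      exact hn ▸ (Finset.card_le_card hc').trans_lt (Finset.card_erase_lt_of_mem hxa)
    have hlam : (MonoidAlgebra.single a.val t : GrpRing G T) • lam p Fr x (a.stalk.erase x) ∈
        K := by
      have hmem : lam p Fr x (a.stalk.erase x) ∈ relFor p Fr F S := Submodule.subset_span
        ⟨x, hxF, ha hxa, _, fun y hy => ⟨hsub hy, (Finset.mem_erase.1 hy).1⟩, rfl⟩
      exact AddSubgroup.mem_sup_right (Submodule.smul_mem _ _ hmem)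
    rw [lam, smul_sub, Finset.insert_erase hxa, single_smul_normElt_smul_base] at hlam
    have hP := hsmall _ (Submodule.smul_mem _ (MonoidAlgebra.single a.val t : GrpRing G T)
      (Submodule.smul_mem _ (aeval (grp (Fr x)⁻¹ : GrpRing G T) (p x))
        (base_mem_freeSub (G := G) (T := T) subset_rfl)))
    have hsum := sub_mem hP hlam
    rw [sub_sub_cancel] at hsum
    rw [← Finset.add_sum_erase _ _ (Finset.mem_univ (1 : G x)), Pi.mulSingle_one, mul_one,
      Symb.ofGrp_val] at hsum
    refine (AddSubgroup.add_mem_cancel_right K (sum_mem fun h hh => ?_)).1 hsum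
    refine ihm _ ?_ (Symb.ofGrp a.stalk (a.val * Pi.mulSingle x h)) ha hn rfl t
    rw [← hm]
    refine Finset.card_lt_card (Finset.ssubset_iff_of_subset ?_ |>.2 ⟨x, ?_, ?_⟩)
    · intro y hy
      simp only [Finset.mem_filter, Symb.stalk_ofGrp, Symb.val_ofGrp] at hy ⊢
      obtain ⟨h1, h2, h3⟩ := hy
      rw [if_pos h1] at h3
      refine ⟨h1, h2, ?_⟩
      by_cases hyx : y = x
      · rw [hyx]; exact hx1
      · simpa [hyx] using h3
    · simp [hxa, hxF, hx1]
    · simp only [Finset.mem_filter, Symb.stalk_ofGrp, Symb.val_ofGrp, if_pos hxa]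
      simpa [hx1, hxa, hxF] using Finset.ne_of_mem_erase hh
  intro a ha
  exact (symbSpan_le fun b hb t => key _ _ b hb rfl rfl t : symbSpan T _ ≤ K)
    (freeSub_le_symbSpan _ ha)

variable (G T) in
/-- The projection that keeps the symbols `[g 𝐳(x) z']` with `g_x = 1` and turns them
into `[g z']`. -/
noncomputable def trivialPart (x : X) : Free G T →+ Free G T :=
  open Classical in
  Finsupp.liftAddHom fun a : Symb G =>
    if x ∈ a.stalk ∧ a.val x = 1 then
      { toFun := fun t : T => single G T (Symb.ofGrp (a.stalk.erase x) a.val) t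
        map_zero' := single_zero _
        map_add' := single_add _ }
    else 0

theorem trivialPart_single_of_not {x : X} {a : Symb G} (h : ¬ (x ∈ a.stalk ∧ a.val x = 1)) (t : T) :
    trivialPart G T x (single G T a t) = 0 := by
  refine (Finsupp.liftAddHom_apply_single _ _ _).trans ?_
  rw [if_neg h]; rfl

theorem trivialPart_single {x : X} {a : Symb G} (h : x ∈ a.stalk ∧ a.val x = 1) (t : T) :
    trivialPart G T x (single G T a t) = single G T (Symb.ofGrp (a.stalk.erase x) a.val) t := by
  refine (Finsupp.liftAddHom_apply_single _ _ _).trans ?_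
  rw [if_pos h]; rfl

theorem trivialPart_reduced {x : X} {F S : Set X} (h : x ∈ F ∨ x ∉ S) {a : Free G T}
    (ha : a ∈ reduced T F S) : trivialPart G T x a = 0 := by
  refine AddSubgroup.mem_bot.1 (map_mem_of_mem_symbSpan _ ⊥ (fun b hb t => ?_) ha)
  refine AddSubgroup.mem_bot.2 (trivialPart_single_of_not (fun hx => ?_) t)
  exact h.elim (fun h => hb.2 x h hx.1 hx.2) fun h => h (hb.1 hx.1)

theorem normHom_single (x : X) (a : Symb G) (t : T) :
    normHom G T x (single G T a t) =
      ∑ h : G x, single G T (Symb.ofGrp (insert x a.stalk) (a.val * Pi.mulSingle x h)) t := by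
  rw [single_eq_smul_base, map_smul, normHom_base, single_smul_normElt_smul_base]

theorem normHom_mem_reduced {x : X} {F S : Set X} (hx : x ∉ F) {a : Free G T}
    (ha : a ∈ reduced T F S) : normHom G T x a ∈ reduced T F Set.univ := by
  refine map_mem_of_mem_symbSpan (normHom G T x).toAddMonoidHom _ (fun b hb t => ?_) ha
  change normHom G T x _ ∈ _
  rw [normHom_single]
  refine sum_mem fun h _ => AddSubgroup.subset_closure
    ⟨_, ⟨Set.subset_univ _, fun y hy hys => ?_⟩, t, rfl⟩
  have hyx : y ≠ x := fun e => hx (e ▸ hy)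
  have hyb := Finset.mem_of_mem_insert_of_ne hys hyx
  simpa [Symb.val_ofGrp, hyx, hyb] using hb.2 y hy hyb

theorem trivialPart_normHom {x : X} {F S : Set X} (hx : x ∉ S) {a : Free G T}
    (ha : a ∈ reduced T F S) : trivialPart G T x (normHom G T x a) = a := by
  refine sub_eq_zero.1 (AddSubgroup.mem_bot.1 (map_mem_of_mem_symbSpan
    ((trivialPart G T x).comp (normHom G T x).toAddMonoidHom - AddMonoidHom.id _) ⊥
      (fun b hb t => ?_) ha))
  have hxb : x ∉ b.stalk := fun h => hx (hb.1 h)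
  refine AddSubgroup.mem_bot.2 (sub_eq_zero.2 ?_)
  change trivialPart G T x (normHom G T x (single G T b t)) = single G T b t
  rw [normHom_single, map_sum, Finset.sum_eq_single 1]
  · rw [trivialPart_single]
    · rw [Symb.stalk_ofGrp, Finset.erase_insert hxb, Pi.mulSingle_one, mul_one]
      conv_rhs => rw [← Symb.ofGrp_val b]
      congr 1
      refine Symb.ofGrp_congr fun y hy => ?_
      rw [Symb.val_ofGrp, if_pos (Finset.mem_insert_of_mem hy)]
    · simp [Symb.val_ofGrp, Symb.val_of_notMem hxb]
  · intro h _ hh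
    refine trivialPart_single_of_not ?_ t
    simpa [Symb.val_ofGrp, Symb.val_of_notMem hxb] using hh
  · simp

/-- The maps `λ_{𝐳(x)}` and `λ_{𝐳(y)}` commute, so `λ_{𝐳(x)}` preserves the relations of the other
primes. -/
theorem lamHom_mem_relFor {x : X} {F : Set X} (hx : x ∉ F) {a : Free G T}
    (ha : a ∈ relFor p Fr F {x}ᶜ) : lamHom p Fr x a ∈ relFor p Fr F Set.univ := by
  refine (Submodule.map_span_le (lamHom p Fr x) _ (relFor p Fr F Set.univ)).2 ?_
    (Submodule.mem_map_of_mem ha)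
  rintro _ ⟨y, hy, -, s, hs, rfl⟩
  have hyx : y ≠ x := fun e => hx (e ▸ hy)
  have h : lamHom p Fr x (lam p Fr y s) =
      aeval (grp (Fr x)⁻¹ : GrpRing G T) (p x) • lam p Fr y s -
        (normElt x : GrpRing G T) • lam p Fr y (insert x s) := by
    rw [lamHom_apply, lam, lam, map_sub, map_smul, map_smul, normHom_base, normHom_base,
      Finset.insert_comm, smul_sub (normElt x), smul_comm (normElt x : GrpRing G T),
      smul_comm (normElt x : GrpRing G T)]
  rw [h]
  refine sub_mem (Submodule.smul_mem _ _ (Submodule.subset_span ⟨y, hy, trivial, s, ?_, rfl⟩))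
    (Submodule.smul_mem _ _ (Submodule.subset_span ⟨y, hy, trivial, insert x s, ?_, rfl⟩))
  · exact fun z hz => ⟨trivial, (hs hz).2⟩
  · intro z hz
    refine ⟨trivial, fun e => ?_⟩
    rcases Finset.mem_insert.1 hz with h | h
    · exact hyx (e.symm.trans h)
    · exact (hs h).2 e

theorem relFor_insert_le (x : X) (F : Set X) :
    relFor p Fr (insert x F) Set.univ ≤
      relFor p Fr F Set.univ ⊔ (freeSub G T {x}ᶜ).map (lamHom p Fr x) := by
  refine Submodule.span_le.2 ?_
  rintro _ ⟨y, hy, -, s, hs, rfl⟩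
  rcases hy with rfl | hy
  · refine Submodule.mem_sup_right ⟨base G T s, base_mem_freeSub fun z hz => (hs hz).2, ?_⟩
    exact lamHom_base p Fr y s
  · exact Submodule.mem_sup_left (Submodule.subset_span ⟨y, hy, trivial, s, hs, rfl⟩)

/-- A combination of reduced symbols that vanishes modulo the relations of finitely many primes is
zero.  Modulo the relations of `F`, the relations of one more prime `x` are the `λ_{𝐳(x)} b` for
reduced `b` prime to `x`; in `λ_{𝐳(x)} b` the coefficients of the symbols `[g 𝐳(x) z']` with
`g_x = 1` are, up to sign, those of `b`, and reduced elements have no such coefficients. -/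
theorem eq_zero_of_mem_reduced_of_mem_relFor (F : Finset X) {a : Free G T}
    (ha : a ∈ reduced T (F : Set X) Set.univ) (ha' : a ∈ relFor p Fr (F : Set X) Set.univ) :
    a = 0 := by
  induction F using Finset.induction_on generalizing a with
  | empty => simpa [relFor] using ha'
  | insert x F hx ih =>
    rw [Finset.coe_insert] at ha ha'
    have hxF : x ∉ (F : Set X) := hx
    have split : ∀ c ∈ freeSub G T ({x}ᶜ : Set X), ∃ b ∈ reduced T (F : Set X) {x}ᶜ,
        ∃ d ∈ relFor p Fr (F : Set X) {x}ᶜ, b + d = c := fun c hc =>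
      AddSubgroup.mem_sup.1 (freeSub_le_reduced_sup p Fr (F : Set X) {x}ᶜ hc)
    obtain ⟨d, hd, _, ⟨c, hc, rfl⟩, rfl⟩ := Submodule.mem_sup.1 (relFor_insert_le p Fr x F ha')
    obtain ⟨b, hb, d', hd', rfl⟩ := split c hc
    have hbf : b ∈ freeSub G T ({x}ᶜ : Set X) :=
      (symbSpan_le fun e he t => single_mem_freeSub he.1 t :
        reduced T (F : Set X) {x}ᶜ ≤ (freeSub G T ({x}ᶜ : Set X)).toAddSubgroup) hb
    obtain ⟨b', hb', d'', hd'', e⟩ := split _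
      (Submodule.smul_mem _ (aeval (grp (Fr x)⁻¹ : GrpRing G T) (p x)) hbf)
    have hmono := relFor_mono p Fr (subset_refl (F : Set X)) (Set.subset_univ ({x}ᶜ : Set X))
    have haF := reduced_mono (G := G) (T := T) (Set.subset_insert x (F : Set X)) subset_rfl ha
    set a := d + lamHom p Fr x (b + d') with hadef
    have hlam := lamHom_apply p Fr x b
    have hzero : a - b' + normHom G T x b = 0 := by
      refine ih (add_mem (sub_mem haF (reduced_mono subset_rfl (Set.subset_univ _) hb'))
        (normHom_mem_reduced hxF hb)) ?_
      have : a - b' + normHom G T x b = d + lamHom p Fr x d' + d'' := by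
        rw [hadef, map_add, hlam, ← e]; abel
      rw [this]
      exact add_mem (add_mem hd (lamHom_mem_relFor p Fr hxF hd')) (hmono hd'')
    have hxc : x ∉ ({x}ᶜ : Set X) := fun h => h rfl
    have hb0 : b = 0 := by
      have := congrArg (trivialPart G T x) hzero
      rw [map_add, map_sub, trivialPart_reduced (Or.inl (Set.mem_insert _ _)) ha,
        trivialPart_reduced (Or.inr hxc) hb',
        trivialPart_normHom hxc hb, map_zero] at this
      simpa using this
    refine ih haF ?_
    rw [hadef, hb0, zero_add]
    exact add_mem hd (lamHom_mem_relFor p Fr hxF hd')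

theorem exists_finset_mem_relFor {a : Free G T} (ha : a ∈ relSub p Fr Set.univ) :
    ∃ F : Finset X, a ∈ relFor p Fr (F : Set X) Set.univ := by
  refine Submodule.span_induction (p := fun a _ => ∃ F : Finset X, a ∈ relFor p Fr (F : Set X) _)
    ?_ ⟨∅, zero_mem _⟩ ?_ ?_ ha
  · rintro _ ⟨x, hx, s, hs, rfl⟩
    exact ⟨{x}, Submodule.subset_span ⟨x, by simp, hx, s, hs, rfl⟩⟩
  · rintro a b - - ⟨F, hF⟩ ⟨F', hF'⟩
    refine ⟨F ∪ F', add_mem (relFor_mono p Fr ?_ subset_rfl hF)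
      (relFor_mono p Fr ?_ subset_rfl hF')⟩ <;> simp
  · rintro r a - ⟨F, hF⟩
    exact ⟨F, Submodule.smul_mem _ r hF⟩

/-- The symbols `[g z']` with no trivial component form a basis of `𝒰_𝐳` over `𝒯`: independence.  A
relation involves finitely many primes only. -/
theorem eq_zero_of_mem_reduced_of_mem_relSub {a : Free G T}
    (ha : a ∈ reduced T (Set.univ : Set X) Set.univ) (ha' : a ∈ relSub p Fr Set.univ) : a = 0 := by
  obtain ⟨F, hF⟩ := exists_finset_mem_relFor p Fr ha'
  exact eq_zero_of_mem_reduced_of_mem_relFor p Fr F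
    (reduced_mono (Set.subset_univ _) subset_rfl ha) hF

/-- The symbols `[g z']` with no trivial component form a basis of `𝒰_z` over `𝒯`: generation. -/
theorem exists_reduced_add_relSub {S : Set X} {a : Free G T} (ha : a ∈ freeSub G T S) :
    ∃ b ∈ reduced T Set.univ S, ∃ d ∈ relSub p Fr S, b + d = a := by
  rw [← relFor_univ]
  exact AddSubgroup.mem_sup.1 (freeSub_le_reduced_sup p Fr Set.univ S ha)

theorem mem_relSub_of_mem_freeSub {S : Set X} {a : Free G T} (ha : a ∈ freeSub G T S)
    (ha' : a ∈ relSub p Fr Set.univ) : a ∈ relSub p Fr S := by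
  obtain ⟨b, hb, d, hd, rfl⟩ := exists_reduced_add_relSub p Fr ha
  have hb0 : b = 0 := eq_zero_of_mem_reduced_of_mem_relSub p Fr
    (reduced_mono subset_rfl (Set.subset_univ _) hb)
    ((Submodule.add_mem_iff_left _ (relSub_mono p Fr (Set.subset_univ S) hd)).1 ha')
  rwa [hb0, zero_add]

variable {p Fr}

/-- `𝒰_z` is a submodule of `𝒰_{z''}` for stalks `z ∣ z''`. -/
theorem incl_injective {S S' : Set X} (h : S ⊆ S') : Function.Injective (incl p Fr h) := by
  refine (injective_iff_map_eq_zero _).2 fun u hu => ?_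
  obtain ⟨a, rfl⟩ := Submodule.Quotient.mk_surjective _ u
  refine (Submodule.Quotient.mk_eq_zero _).2 (mem_relSub_of_mem_freeSub p Fr a.2 ?_)
  have hu' : (a : Free G T) ∈ relSub p Fr S' := (Submodule.Quotient.mk_eq_zero
    ((relSub p Fr S').submoduleOf (freeSub G T S'))).1 hu
  exact relSub_mono p Fr (Set.subset_univ S') hu'

variable {O : Type*} [CommRing O] [Algebra O T]

theorem scal_smul_injective [IsDomain O] [Module.IsTorsionFree O T] {M : O} (hM : M ≠ 0)
    (S : Set X) {u v : Univ p Fr S}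
    (h : (scal M : GrpRing G T) • u = (scal M : GrpRing G T) • v) : u = v := by
  rw [← sub_eq_zero, ← smul_sub] at h
  rw [← sub_eq_zero]
  generalize u - v = w at h
  obtain ⟨⟨a, ha⟩, rfl⟩ := Submodule.Quotient.mk_surjective _ w
  refine (Submodule.Quotient.mk_eq_zero _).2 (?_ : a ∈ relSub p Fr S)
  have h' : (scal M : GrpRing G T) • a ∈ relSub p Fr S := (Submodule.Quotient.mk_eq_zero
    ((relSub p Fr S).submoduleOf (freeSub G T S))).1 h
  obtain ⟨b, hb, d, hd, rfl⟩ := exists_reduced_add_relSub p Fr ha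
  rw [smul_add, Submodule.add_mem_iff_left _ (Submodule.smul_mem _ _ hd)] at h'
  have hb0 : b = 0 := eq_zero_of_scal_smul_free hM (eq_zero_of_mem_reduced_of_mem_relSub p Fr
    (scal_smul_symbSpan M (reduced_mono subset_rfl (Set.subset_univ _) hb))
    (relSub_mono p Fr (Set.subset_univ S) h'))
  rwa [hb0, zero_add]

end Structure

/-! ### The quotient of `𝒰_𝐳` by `I_x` -/

section Specialization

variable {X : Type*} [DecidableEq X] {G : X → Type*} [∀ x, CommGroup (G x)]
  [∀ x, Fintype (G x)] {T : Type*} [CommRing T] {p : X → T[X]} {Fr : X → Grp G}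

theorem Univ.mem_of_symb_mem {S : Set X} (K : Submodule (GrpRing G T) (Univ p Fr S))
    (h : ∀ s hs, symb p Fr S s hs ∈ K) (u : Univ p Fr S) : u ∈ K := by
  obtain ⟨⟨a, ha⟩, rfl⟩ := Submodule.Quotient.mk_surjective _ u
  refine Submodule.span_induction
    (p := fun a ha => (Submodule.Quotient.mk ⟨a, ha⟩ : Univ p Fr S) ∈ K) ?_ ?_ ?_ ?_ ha
  · rintro _ ⟨s, hs, rfl⟩
    exact h s hs
  · exact zero_mem K
  · intro a b ha hb h h'
    exact add_mem h h'
  · intro r a ha h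
    exact K.smul_mem r h

theorem Univ.hom_ext {V : Type*} [AddCommGroup V] [Module (GrpRing G T) V] {S : Set X}
    {f f' : Univ p Fr S →ₗ[GrpRing G T] V}
    (h : ∀ s hs, f (symb p Fr S s hs) = f' (symb p Fr S s hs)) (u : Univ p Fr S) : f u = f' u :=
  Univ.mem_of_symb_mem (LinearMap.eqLocus f f') h u

theorem incl_symb {S S' : Set X} (h : S ⊆ S') (s : Finset X) (hs : (s : Set X) ⊆ S) :
    incl p Fr h (symb p Fr S s hs) = symb p Fr S' s (hs.trans h) := rfl

theorem grp_smul_symb {S : Set X} {s : Finset X} (hs : (s : Set X) ⊆ S) {g : Grp G}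
    (H : ∀ x ∈ s, g x = 1) :
    (grp g : GrpRing G T) • symb p Fr S s hs = symb p Fr S s hs := by
  refine congrArg Submodule.Quotient.mk (Subtype.ext ?_)
  exact grp_smul_base H

theorem grp_smul_univ {S : Set X} {x : X} (hx : x ∉ S) (g : G x) (u : Univ p Fr S) :
    (grp (Pi.mulSingle x g) : GrpRing G T) • u = u := by
  refine Univ.hom_ext (f := LinearMap.lsmul (GrpRing G T) (Univ p Fr S) (grp (Pi.mulSingle x g)))
    (f' := LinearMap.id) (fun s hs => ?_) u
  exact grp_smul_symb hs fun y hy => Pi.mulSingle_eq_of_ne (ne_of_mem_of_not_mem (hs hy) hx) _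

theorem normElt_smul_symb {x : X} {s : Finset X} {S : Set X} (hx : x ∉ s) (hxS : x ∈ S)
    (hs : (s : Set X) ⊆ S) (hs' : ((insert x s : Finset X) : Set X) ⊆ S) :
    (normElt x : GrpRing G T) • symb p Fr S (insert x s) hs' =
      aeval (grp (Fr x)⁻¹ : GrpRing G T) (p x) • symb p Fr S s hs := by
  refine (sub_eq_zero.1 ((Submodule.Quotient.mk_eq_zero _).2 ?_)).symm
  refine (Submodule.subset_span ⟨x, hxS, s, fun y hy => ⟨hs hy, ?_⟩, rfl⟩ :
    lam p Fr x s ∈ relSub p Fr S)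
  exact ne_of_mem_of_not_mem hy hx

variable {O : Type*} [CommRing O] [Algebra O T] (r : X → O[X])

variable (Fr) in
/-- The `𝒯[G_𝐳]`-linear map with `[𝐳(x) z'] ↦ r_x(Fr_x⁻¹)[z']` and `[z'] ↦ [z']` for `x ∤ z'`. -/
noncomputable def remove (x : X) : Free G T →ₗ[GrpRing G T] Free G T :=
  lift (fun s => if x ∈ s then aeval (grp (Fr x)⁻¹ : GrpRing G T) (r x) • base G T (s.erase x)
    else base G T s) fun s g hg => by
      split_ifs
      · rw [smul_comm, grp_smul_base fun y hy => hg y (Finset.mem_of_mem_erase hy)]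
      · exact grp_smul_base hg

theorem remove_base_of_mem {x : X} {s : Finset X} (hx : x ∈ s) :
    remove (T := T) Fr r x (base G T s) =
      aeval (grp (Fr x)⁻¹ : GrpRing G T) (r x) • base G T (s.erase x) :=
  (lift_base _ _ s).trans (if_pos hx)

theorem remove_base_of_notMem {x : X} {s : Finset X} (hx : x ∉ s) :
    remove (T := T) Fr r x (base G T s) = base G T s :=
  (lift_base _ _ s).trans (if_neg hx)

theorem remove_mem_freeSub {x : X} {S S' : Set X} (h : S \ {x} ⊆ S') {a : Free G T}
    (ha : a ∈ freeSub G T S) : remove (T := T) Fr r x a ∈ freeSub G T S' := by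
  refine (Submodule.map_span_le (remove (T := T) Fr r x) _ (freeSub G T S')).2 ?_
    (Submodule.mem_map_of_mem ha)
  rintro _ ⟨s, hs, rfl⟩
  by_cases hx : x ∈ s
  · rw [remove_base_of_mem r hx]
    exact Submodule.smul_mem _ _ (base_mem_freeSub fun y hy =>
      h ⟨hs (Finset.mem_of_mem_erase hy), Finset.ne_of_mem_erase hy⟩)
  · rw [remove_base_of_notMem r hx]
    exact base_mem_freeSub fun y hy => h ⟨hs hy, ne_of_mem_of_not_mem hy hx⟩

theorem remove_lam_self {x : X} {s : Finset X} (hx : x ∉ s) :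
    remove Fr r x (lam p Fr x s) = gam p Fr r x • base G T s := by
  rw [lam, map_sub, map_smul, map_smul, remove_base_of_notMem r hx,
    remove_base_of_mem r (Finset.mem_insert_self x s), Finset.erase_insert hx, gam, sub_smul,
    mul_smul, smul_comm (normElt x : GrpRing G T), normElt_smul_base hx]

theorem remove_lam_of_mem {x y : X} (hyx : y ≠ x) {s : Finset X} (hx : x ∈ s) :
    remove Fr r x (lam p Fr y s) =
      aeval (grp (Fr x)⁻¹ : GrpRing G T) (r x) • lam p Fr y (s.erase x) := by
  rw [lam, map_sub, map_smul, map_smul, remove_base_of_mem r hx,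
    remove_base_of_mem r (Finset.mem_insert_of_mem hx), Finset.erase_insert_of_ne hyx, lam,
    smul_sub, smul_comm (normElt y : GrpRing G T), smul_comm (aeval _ (p y))]

theorem remove_lam_of_notMem {x y : X} (hyx : y ≠ x) {s : Finset X} (hx : x ∉ s) :
    remove Fr r x (lam p Fr y s) = lam p Fr y s := by
  have hx' : x ∉ insert y s := fun h => (Finset.mem_insert.1 h).elim (fun e => hyx e.symm) hx
  rw [lam, map_sub, map_smul, map_smul, remove_base_of_notMem r hx, remove_base_of_notMem r hx']

theorem remove_mem_relSub_sup {x : X} {S S' : Set X} (h : S \ {x} ⊆ S') {a : Free G T}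
    (ha : a ∈ relSub p Fr S) : remove Fr r x a ∈
      relSub p Fr S' ⊔ (freeSub G T S').map (LinearMap.lsmul _ _ (gam p Fr r x)) := by
  refine (Submodule.map_span_le (remove (T := T) Fr r x) _ (relSub p Fr S' ⊔ _)).2 ?_
    (Submodule.mem_map_of_mem ha)
  rintro _ ⟨y, hy, s, hs, rfl⟩
  by_cases hyx : y = x
  · subst hyx
    have hys : y ∉ s := fun hy' => (hs hy').2 rfl
    rw [remove_lam_self r hys]
    exact Submodule.mem_sup_right ⟨_, base_mem_freeSub (hs.trans h), rfl⟩
  · by_cases hx : x ∈ s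
    · rw [remove_lam_of_mem r hyx hx]
      refine Submodule.mem_sup_left (Submodule.smul_mem _ _ (Submodule.subset_span
        ⟨y, h ⟨hy, hyx⟩, _, fun z hz => ⟨h ⟨?_, Finset.ne_of_mem_erase hz⟩, ?_⟩, rfl⟩))
      · exact (hs (Finset.mem_of_mem_erase hz)).1
      · exact (hs (Finset.mem_of_mem_erase hz)).2
    · rw [remove_lam_of_notMem r hyx hx]
      exact Submodule.mem_sup_left (Submodule.subset_span ⟨y, h ⟨hy, hyx⟩, s, fun z hz =>
        ⟨h ⟨(hs hz).1, ne_of_mem_of_not_mem hz hx⟩, (hs hz).2⟩, rfl⟩)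

variable (p Fr) in
/-- The homomorphism `𝒰_z → 𝒰_{z'} / γ_x 𝒰_{z'}` with `[𝐳(x) z''] ↦ r_x(Fr_x⁻¹)[z'']` and
`[z''] ↦ [z'']` for `x ∤ z''`, where `z'` is a stalk that contains all primes of `z` except,
possibly, `x`. -/
noncomputable def special (x : X) {S S' : Set X} (h : S \ {x} ⊆ S') :
    Univ p Fr S →ₗ[GrpRing G T] QuotSMulTop (gam p Fr r x) (Univ p Fr S') :=
  Submodule.liftQ _
    ((Submodule.mkQ _ ∘ₗ Submodule.mkQ ((relSub p Fr S').submoduleOf (freeSub G T S'))) ∘ₗ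
      (remove Fr r x).restrict fun _ ha => remove_mem_freeSub r h ha) fun a ha => by
    obtain ⟨d, hd, _, ⟨c, hc, rfl⟩, e⟩ := Submodule.mem_sup.1
      (remove_mem_relSub_sup r h (show (a : Free G T) ∈ relSub p Fr S from ha))
    refine (Submodule.Quotient.mk_eq_zero _).2
      ((Submodule.mem_smul_pointwise_iff_exists _ _ _).2
        ⟨Submodule.Quotient.mk ⟨c, hc⟩, trivial, ?_⟩)
    refine ((Submodule.Quotient.eq ((relSub p Fr S').submoduleOf (freeSub G T S'))).2 ?_).symm
    change remove Fr r x (a : Free G T) - gam p Fr r x • c ∈ relSub p Fr S'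
    rw [← e]
    simpa using hd

variable {r}

theorem special_symb_of_mem {x : X} {S S' : Set X} (h : S \ {x} ⊆ S') {s : Finset X}
    (hs : (s : Set X) ⊆ S) (hx : x ∈ s) (hs' : ((s.erase x : Finset X) : Set X) ⊆ S') :
    special p Fr r x h (symb p Fr S s hs) = Submodule.Quotient.mk
      (aeval (grp (Fr x)⁻¹ : GrpRing G T) (r x) • symb p Fr S' (s.erase x) hs') :=
  congrArg (fun a => Submodule.Quotient.mk (Submodule.Quotient.mk a))
    (Subtype.ext (remove_base_of_mem r hx))

theorem special_symb_of_notMem {x : X} {S S' : Set X} (h : S \ {x} ⊆ S') {s : Finset X}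
    (hs : (s : Set X) ⊆ S) (hx : x ∉ s) (hs' : (s : Set X) ⊆ S') :
    special p Fr r x h (symb p Fr S s hs) = Submodule.Quotient.mk (symb p Fr S' s hs') :=
  congrArg (fun a => Submodule.Quotient.mk (Submodule.Quotient.mk a))
    (Subtype.ext (remove_base_of_notMem r hx))

theorem mk_gam_eq_zero_iff {x : X} {S : Set X} {u : Univ p Fr S} :
    (Submodule.Quotient.mk u : QuotSMulTop (gam p Fr r x) (Univ p Fr S)) = 0 ↔
      ∃ c, gam p Fr r x • c = u := by
  rw [Submodule.Quotient.mk_eq_zero, Submodule.mem_smul_pointwise_iff_exists]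
  simp

theorem special_incl {x : X} {S S' : Set X} (h : S \ {x} ⊆ S') (h' : S' ⊆ S) (hx : x ∉ S')
    (u : Univ p Fr S') : special p Fr r x h (incl p Fr h' u) = Submodule.Quotient.mk u := by
  let π : Univ p Fr S' →ₗ[GrpRing G T] QuotSMulTop (gam p Fr r x) (Univ p Fr S') :=
    Submodule.mkQ _
  refine Univ.hom_ext (f := special p Fr r x h ∘ₗ incl p Fr h') (f' := π) (fun s hs => ?_) u
  rw [LinearMap.comp_apply, incl_symb]
  exact special_symb_of_notMem h _ (fun h => hx (hs h)) hs

theorem special_naturality {x : X} {S S' V V' : Set X} (h : S \ {x} ⊆ S') (h' : V \ {x} ⊆ V')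
    (hS : S ⊆ V) (hS' : S' ⊆ V') (u : Univ p Fr S) :
    special p Fr r x h' (incl p Fr hS u) =
      QuotSMulTop.map (gam p Fr r x) (incl p Fr hS') (special p Fr r x h u) := by
  refine Univ.hom_ext (f := special p Fr r x h' ∘ₗ incl p Fr hS)
    (f' := QuotSMulTop.map (gam p Fr r x) (incl p Fr hS') ∘ₗ special p Fr r x h) (fun s hs => ?_) u
  rw [LinearMap.comp_apply, LinearMap.comp_apply, incl_symb]
  by_cases hx : x ∈ s
  · have hs' : ((s.erase x : Finset X) : Set X) ⊆ S' := fun y hy =>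
      h ⟨hs (Finset.mem_of_mem_erase hy), Finset.ne_of_mem_erase hy⟩
    rw [special_symb_of_mem h hs hx hs', special_symb_of_mem h' _ hx (hs'.trans hS')]
    rfl
  · have hs' : (s : Set X) ⊆ S' := fun y hy => h ⟨hs hy, ne_of_mem_of_not_mem hy hx⟩
    rw [special_symb_of_notMem h hs hx hs', special_symb_of_notMem h' _ hx (hs'.trans hS')]
    rfl

theorem special_one_sub_smul {x : X} {S S' : Set X} (h : S \ {x} ⊆ S') (hx : x ∉ S') (g : G x)
    (u : Univ p Fr S) : special p Fr r x h
      ((1 - grp (Pi.mulSingle x g) : GrpRing G T) • u) = 0 := by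
  rw [map_smul, sub_smul, one_smul, sub_eq_zero]
  obtain ⟨v, hv⟩ := Submodule.Quotient.mk_surjective _ (special p Fr r x h u)
  rw [← hv, ← Submodule.Quotient.mk_smul, grp_smul_univ hx]

theorem gam_smul_incl_mem_idl {x : X} (u : Univ p Fr ({x}ᶜ : Set X)) :
    gam p Fr r x • incl p Fr (Set.subset_univ _) u ∈ idl p Fr r x := by
  refine Univ.mem_of_symb_mem ((idl p Fr r x).comap
    (gam p Fr r x • incl p Fr (Set.subset_univ _))) (fun s hs => ?_) u
  change gam p Fr r x • symb p Fr Set.univ s (Set.subset_univ _) ∈ idl p Fr r x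
  have hx : x ∉ s := fun h => hs h rfl
  -- `γ_x [z'] = -∑ (r_x(Fr_x⁻¹)[z'] - g[𝐳(x) z'])`, the sum over `g ∈ G_{𝐳(x)}`
  rw [gam, sub_smul, ← normElt_smul_symb hx (Set.mem_univ x) _ (Set.subset_univ _), mul_comm,
    mul_smul, Nat.cast_smul_eq_nsmul, ← Finset.card_univ, ← Finset.sum_const, normElt,
    Finset.sum_smul, ← neg_sub, ← Finset.sum_sub_distrib]
  exact neg_mem (sum_mem fun g _ => Submodule.subset_span ⟨s, g, hx, Or.inr rfl⟩)

theorem exists_sub_incl_mem_idl {x : X} (u : Univ p Fr (Set.univ : Set X)) :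
    ∃ v : Univ p Fr ({x}ᶜ : Set X), u - incl p Fr (Set.subset_univ _) v ∈ idl p Fr r x := by
  have := Univ.mem_of_symb_mem (idl p Fr r x ⊔ LinearMap.range
    (incl p Fr (Set.subset_univ ({x}ᶜ : Set X)))) (fun s hs => ?_) u
  · obtain ⟨d, hd, _, ⟨v, rfl⟩, rfl⟩ := Submodule.mem_sup.1 this
    exact ⟨v, by simpa using hd⟩
  · by_cases hx : x ∈ s
    · have hsx : ((s.erase x : Finset X) : Set X) ⊆ {x}ᶜ := fun y hy => Finset.ne_of_mem_erase hy
      have hgen : aeval (grp (Fr x)⁻¹ : GrpRing G T) (r x) •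
          symb p Fr Set.univ (s.erase x) (Set.subset_univ _) - symb p Fr Set.univ s hs ∈
            idl p Fr r x := by
        refine Submodule.subset_span ⟨s.erase x, 1, Finset.notMem_erase x s, Or.inr ?_⟩
        rw [Pi.mulSingle_one, grp_one, one_smul]
        simp only [Finset.insert_erase hx]
      rw [← sub_sub_cancel (aeval (grp (Fr x)⁻¹ : GrpRing G T) (r x) •
        symb p Fr Set.univ (s.erase x) (Set.subset_univ _)) (symb p Fr Set.univ s hs)]
      refine sub_mem (Submodule.smul_mem _ _ (Submodule.mem_sup_right ?_))
        (Submodule.mem_sup_left hgen)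
      exact ⟨symb p Fr _ _ hsx, rfl⟩
    · exact Submodule.mem_sup_right ⟨symb p Fr _ s fun y hy => ne_of_mem_of_not_mem hy hx, rfl⟩

/-- `I_x` is the kernel of `𝒰_𝐳 → 𝒰_{𝐳/𝐳(x)} / γ_x 𝒰_{𝐳/𝐳(x)}`. -/
theorem mem_idl_iff {x : X} (h : (Set.univ : Set X) \ {x} ⊆ {x}ᶜ)
    {u : Univ p Fr (Set.univ : Set X)} :
    u ∈ idl p Fr r x ↔ special p Fr r x h u = 0 := by
  have hxc : x ∉ ({x}ᶜ : Set X) := fun h => h rfl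
  have hle : idl p Fr r x ≤ LinearMap.ker (special p Fr r x h) := by
    refine Submodule.span_le.2 ?_
    rintro _ ⟨s, g, hx, rfl | rfl⟩
    · have := special_one_sub_smul (r := r) h hxc g
        (symb p Fr Set.univ (insert x s) (Set.subset_univ _))
      rwa [sub_smul, one_smul] at this
    · have hs : (s : Set X) ⊆ {x}ᶜ := fun y hy => ne_of_mem_of_not_mem hy hx
      have hs' : (((insert x s).erase x : Finset X) : Set X) ⊆ {x}ᶜ :=
        fun y hy => Finset.ne_of_mem_erase hy
      change special p Fr r x h _ = 0
      rw [map_sub, map_smul, map_smul, special_symb_of_notMem h _ hx hs,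
        special_symb_of_mem h _ (Finset.mem_insert_self x s) hs', ← Submodule.Quotient.mk_smul,
        ← Submodule.Quotient.mk_smul, grp_smul_univ hxc, sub_eq_zero]
      simp only [Finset.erase_insert hx]
  refine ⟨fun hu => hle hu, fun hu => ?_⟩
  obtain ⟨v, hv⟩ := exists_sub_incl_mem_idl (r := r) (x := x) u
  have := hle hv
  rw [LinearMap.mem_ker, map_sub, hu, zero_sub, neg_eq_zero, special_incl h _ hxc,
    mk_gam_eq_zero_iff] at this
  obtain ⟨c, rfl⟩ := this
  rw [map_smul] at hv
  exact (Submodule.sub_mem_iff_left _ (gam_smul_incl_mem_idl c)).1 hv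

/-- The congruence modulo `I_x` between `𝒰_𝐳` and `𝒰_{𝐳/𝐳(x)}`, in terms of the quotient
`𝒰_{𝐳/𝐳(x)} / γ_x 𝒰_{𝐳/𝐳(x)}`. -/
theorem sub_incl_mem_idl_iff {x : X} (h : (Set.univ : Set X) \ {x} ⊆ {x}ᶜ)
    {q : Univ p Fr (Set.univ : Set X)} {q' : Univ p Fr ({x}ᶜ : Set X)} :
    q - incl p Fr (Set.subset_univ _) q' ∈ idl p Fr r x ↔
      special p Fr r x h q = Submodule.Quotient.mk q' := by
  rw [mem_idl_iff h, map_sub, special_incl h _ fun h => h rfl, sub_eq_zero]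

end Specialization

/-! ### The map `Δ_x` -/

section Derivative

variable {X : Type*} [DecidableEq X] {G : X → Type*} [∀ x, CommGroup (G x)]
  [∀ x, Fintype (G x)] {T : Type*} [CommRing T] {p : X → T[X]} {Fr : X → Grp G}
  {O : Type*} [CommRing O] [Algebra O T] {r : X → O[X]} {M : O}

theorem red_eq_zero_iff {S : Set X} {u : Univ p Fr S} :
    red p Fr M S u = 0 ↔ ∃ c, (scal M : GrpRing G T) • c = u := by
  refine (Submodule.Quotient.mk_eq_zero _).trans ?_
  rw [Submodule.mem_smul_pointwise_iff_exists]
  simp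

theorem red_surjective (S : Set X) : Function.Surjective (red p Fr M S) :=
  Submodule.mkQ_surjective _

theorem red_mem_H0Mod_iff {S : Set X} {u : Univ p Fr S} :
    red p Fr M S u ∈ H0Mod p Fr M S ↔
      ∀ g : Grp G, ∃ c, (scal M : GrpRing G T) • c = (grp g : GrpRing G T) • u - u := by
  refine forall_congr' fun g => ?_
  rw [← red_eq_zero_iff, map_sub, map_smul, sub_eq_zero]

theorem exists_scal_smul_eq_one_sub_smul {S : Set X} {u : Univ p Fr S}
    (hu : red p Fr M S u ∈ H0Mod p Fr M S) (g : Grp G) :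
    ∃ q, (scal M : GrpRing G T) • q = (1 - grp g : GrpRing G T) • u := by
  obtain ⟨c, hc⟩ := red_mem_H0Mod_iff.1 hu g
  exact ⟨-c, by rw [smul_neg, hc, sub_smul, one_smul, neg_sub]⟩

/-- On invariant classes modulo `M`, the element `γ_x` acts as `p(x; 1) - r_x(1) |G_{𝐳(x)}|`,
and `M` divides both terms. -/
theorem exists_scal_smul_eq_gam_smul {x : X} (hMG : M ∣ (Fintype.card (G x) : O))
    (hMp : algebraMap O T M ∣ (p x).eval 1) {S : Set X} {u : Univ p Fr S}
    (hu : red p Fr M S u ∈ H0Mod p Fr M S) :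
    ∃ q, (scal M : GrpRing G T) • q = gam p Fr r x • u := by
  obtain ⟨c, hc⟩ := red_mem_H0Mod_iff.1 hu (Fr x)⁻¹
  obtain ⟨m, hm⟩ := hMG
  obtain ⟨t, ht⟩ := hMp
  obtain ⟨k, hk⟩ := ((p x).map (algebraMap T (GrpRing G T))).sub_dvd_eval_sub (grp (Fr x)⁻¹) 1
  have hP : aeval (grp (Fr x)⁻¹ : GrpRing G T) (p x) =
      (scal M : GrpRing G T) * algebraMap T (GrpRing G T) t + k * (grp (Fr x)⁻¹ - 1) := by
    rw [eval_map_algebraMap, eval_one_map, ht, map_mul] at hk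
    exact (sub_eq_iff_eq_add'.1 hk).trans (by rw [mul_comm k]; rfl)
  have hC : (Fintype.card (G x) : GrpRing G T) = (scal M : GrpRing G T) * scal m := by
    have := congrArg (algebraMap O (GrpRing G T)) hm
    rwa [map_natCast, map_mul] at this
  refine ⟨algebraMap T (GrpRing G T) t • u + k • c -
    aeval (grp (Fr x)⁻¹ : GrpRing G T) (r x) • (scal m : GrpRing G T) • u, ?_⟩
  rw [gam, hP, hC, sub_smul, add_smul, smul_sub, smul_add, mul_smul k, sub_smul, one_smul, ← hc]
  simp only [smul_smul]
  congr 2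
  · rw [mul_comm k]
  · ring

/-- The derivative at `x` of an invariant class modulo `M`, at the level of representatives. If
`M q = (1 - g) a` and `q'` represents the image of `q` in `𝒰_{z'} / γ_x 𝒰_{z'}`, then
`M q' = γ_x b` for some `b`, since `1 - g` acts as `0` there. -/
theorem exists_derivative [IsDomain O] [Module.IsTorsionFree O T] (hM : M ≠ 0) {x : X}
    {S S' : Set X} (h : S \ {x} ⊆ S') (hx : x ∉ S')
    (hγ : ∀ b : Univ p Fr S', gam p Fr r x • b = 0 → b = 0) (g : G x) {a : Univ p Fr S}
    (ha : red p Fr M S a ∈ H0Mod p Fr M S) :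
    ∃ (q : Univ p Fr S) (q' b : Univ p Fr S'),
      (scal M : GrpRing G T) • q = (1 - grp (Pi.mulSingle x g) : GrpRing G T) • a ∧
      (scal M : GrpRing G T) • q' = gam p Fr r x • b ∧
      special p Fr r x h q = Submodule.Quotient.mk q' ∧
      red p Fr M S' b ∈ H0Mod p Fr M S' := by
  obtain ⟨q, hq⟩ := exists_scal_smul_eq_one_sub_smul ha (Pi.mulSingle x g)
  obtain ⟨q', hq'⟩ := Submodule.Quotient.mk_surjective _ (special p Fr r x h q)
  have hMq' : (Submodule.Quotient.mk ((scal M : GrpRing G T) • q') :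
      QuotSMulTop (gam p Fr r x) (Univ p Fr S')) = 0 := by
    rw [Submodule.Quotient.mk_smul, hq', ← map_smul, hq, special_one_sub_smul h hx]
  obtain ⟨b, hb⟩ := mk_gam_eq_zero_iff.1 hMq'
  refine ⟨q, q', b, hq, hb.symm, hq'.symm, red_mem_H0Mod_iff.2 fun k => ?_⟩
  obtain ⟨a', ha'⟩ := red_mem_H0Mod_iff.1 ha k
  have hkq : (grp k : GrpRing G T) • q - q =
      (1 - grp (Pi.mulSingle x g) : GrpRing G T) • a' := by
    refine scal_smul_injective hM S ?_
    rw [smul_sub, smul_comm (scal M : GrpRing G T), hq, smul_comm (scal M : GrpRing G T) (1 - _),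
      ha', smul_sub, smul_comm (grp k : GrpRing G T)]
  have hkq' : (Submodule.Quotient.mk ((grp k : GrpRing G T) • q' - q') :
      QuotSMulTop (gam p Fr r x) (Univ p Fr S')) = 0 := by
    rw [Submodule.Quotient.mk_sub, Submodule.Quotient.mk_smul, hq', ← map_smul, ← map_sub, hkq,
      special_one_sub_smul h hx]
  obtain ⟨c, hc⟩ := mk_gam_eq_zero_iff.1 hkq'
  refine ⟨c, sub_eq_zero.1 (hγ _ ?_)⟩
  rw [smul_sub, smul_comm, hc, smul_sub, smul_sub, smul_comm (gam p Fr r x), hb,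
    smul_comm (scal M : GrpRing G T), sub_self]

variable {σ : ∀ x, G x} {x : X} {a a₁ a₂ : Univ p Fr (Set.univ : Set X)}
  {b b₁ b₂ : Univ p Fr ({x}ᶜ : Set X)}

theorem Cong.add (h₁ : Cong p Fr r M σ x a₁ b₁) (h₂ : Cong p Fr r M σ x a₂ b₂) :
    Cong p Fr r M σ x (a₁ + a₂) (b₁ + b₂) := by
  obtain ⟨q₁, q₁', e₁, e₁', m₁⟩ := h₁
  obtain ⟨q₂, q₂', e₂, e₂', m₂⟩ := h₂
  refine ⟨q₁ + q₂, q₁' + q₂', by rw [smul_add, smul_add, e₁, e₂],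
    by rw [smul_add, smul_add, e₁', e₂'], ?_⟩
  rw [map_add, add_sub_add_comm]
  exact add_mem m₁ m₂

theorem Cong.smul (k : GrpRing G T) (h : Cong p Fr r M σ x a b) :
    Cong p Fr r M σ x (k • a) (k • b) := by
  obtain ⟨q, q', e, e', m⟩ := h
  refine ⟨k • q, k • q', by rw [smul_comm, e, smul_comm], by rw [smul_comm, e', smul_comm], ?_⟩
  rw [map_smul, ← smul_sub]
  exact Submodule.smul_mem _ _ m

theorem Cong.sub (h₁ : Cong p Fr r M σ x a₁ b₁) (h₂ : Cong p Fr r M σ x a₂ b₂) :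
    Cong p Fr r M σ x (a₁ - a₂) (b₁ - b₂) := by
  have := h₁.add (h₂.smul (-1))
  rwa [neg_one_smul, neg_one_smul, ← sub_eq_add_neg, ← sub_eq_add_neg] at this

theorem notMem_compl_self (x : X) : x ∉ ({x}ᶜ : Set X) := fun h => h rfl

theorem univ_sdiff_subset (x : X) : (Set.univ : Set X) \ {x} ⊆ {x}ᶜ := fun _ h => h.2

/-- The congruence holds for elements that vanish modulo `M`. -/
theorem Cong.of_red_eq_zero (ha : red p Fr M _ a = 0) (hb : red p Fr M _ b = 0) :
    Cong p Fr r M σ x a b := by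
  obtain ⟨c, rfl⟩ := red_eq_zero_iff.1 ha
  obtain ⟨d, rfl⟩ := red_eq_zero_iff.1 hb
  refine ⟨_, _, smul_comm _ _ c, smul_comm _ _ d, ?_⟩
  rw [sub_incl_mem_idl_iff (univ_sdiff_subset x), special_one_sub_smul _ (notMem_compl_self x)]
  exact (mk_gam_eq_zero_iff.2 ⟨d, rfl⟩).symm

/-- The class of `b` modulo `M` is determined by that of `a`. -/
theorem Cong.red_eq_zero [IsDomain O] [Module.IsTorsionFree O T] (hM : M ≠ 0)
    (hγ : ∀ b : Univ p Fr ({x}ᶜ : Set X), gam p Fr r x • b = 0 → b = 0)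
    (h : Cong p Fr r M σ x a b) (ha : red p Fr M _ a = 0) : red p Fr M _ b = 0 := by
  obtain ⟨q, q', e, e', m⟩ := h
  obtain ⟨c, rfl⟩ := red_eq_zero_iff.1 ha
  rw [smul_comm] at e
  rw [scal_smul_injective hM _ e, sub_incl_mem_idl_iff (univ_sdiff_subset x),
    special_one_sub_smul _ (notMem_compl_self x)] at m
  obtain ⟨d, rfl⟩ := mk_gam_eq_zero_iff.1 m.symm
  refine red_eq_zero_iff.2 ⟨d, sub_eq_zero.1 (hγ _ ?_)⟩
  rw [smul_sub, smul_comm, e', sub_self]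

theorem Cong.red_eq_red [IsDomain O] [Module.IsTorsionFree O T] (hM : M ≠ 0)
    (hγ : ∀ b : Univ p Fr ({x}ᶜ : Set X), gam p Fr r x • b = 0 → b = 0)
    (h₁ : Cong p Fr r M σ x a₁ b₁) (h₂ : Cong p Fr r M σ x a₂ b₂)
    (ha : red p Fr M _ a₁ = red p Fr M _ a₂) : red p Fr M _ b₁ = red p Fr M _ b₂ := by
  rw [← sub_eq_zero, ← map_sub] at ha ⊢
  exact (h₁.sub h₂).red_eq_zero hM hγ ha

theorem exists_cong [IsDomain O] [Module.IsTorsionFree O T] (hM : M ≠ 0)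
    (hγ : ∀ b : Univ p Fr ({x}ᶜ : Set X), gam p Fr r x • b = 0 → b = 0)
    (σ : ∀ x, G x) (c : H0Mod p Fr M (Set.univ : Set X)) :
    ∃ (d : H0Mod p Fr M ({x}ᶜ : Set X)) (a : Univ p Fr (Set.univ : Set X))
      (b : Univ p Fr ({x}ᶜ : Set X)), red p Fr M _ a = c ∧ red p Fr M _ b = d ∧
        Cong p Fr r M σ x a b := by
  obtain ⟨c, hc⟩ := c
  obtain ⟨a, rfl⟩ := red_surjective _ c
  obtain ⟨q, q', b, e, e', m, hb⟩ :=
    exists_derivative hM (univ_sdiff_subset x) (notMem_compl_self x) hγ (σ x) hc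
  exact ⟨⟨_, hb⟩, a, b, rfl, rfl, q, q', e, e', (sub_incl_mem_idl_iff _).2 m⟩

/-- The map `Δ_x` exists and is linear: the congruence is a relation on classes modulo `M` that
is compatible with addition and scalars, total (`exists_cong`) and functional
(`Cong.red_eq_red`). -/
theorem exists_isDelta [IsDomain O] [Module.IsTorsionFree O T] (hM : M ≠ 0)
    (hγ : ∀ b : Univ p Fr ({x}ᶜ : Set X), gam p Fr r x • b = 0 → b = 0) (σ : ∀ x, G x) :
    ∃ Δ : H0Mod p Fr M (Set.univ : Set X) →ₗ[GrpRing G T] H0Mod p Fr M ({x}ᶜ : Set X),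
      IsDelta p Fr r M σ x Δ := by
  choose f α β hα hβ hcong using exists_cong (M := M) hM hγ σ
  have hf : ∀ (c : H0Mod p Fr M (Set.univ : Set X)) a b,
      red p Fr M _ a = c → Cong p Fr r M σ x a b → red p Fr M _ b = f c :=
    fun c a b hac h => (h.red_eq_red hM hγ (hcong c) (hac.trans (hα c).symm)).trans (hβ c)
  refine ⟨{ toFun := f, map_add' := fun c d => ?_, map_smul' := fun k c => ?_ }, ?_⟩
  · refine Subtype.ext ((hf _ _ _ ?_ ((hcong c).add (hcong d))).symm.trans ?_)
    · rw [map_add, hα, hα]; rfl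
    · rw [map_add, hβ, hβ]; rfl
  · refine Subtype.ext ((hf _ _ _ ?_ ((hcong c).smul k)).symm.trans ?_)
    · rw [map_smul, hα]; rfl
    · rw [map_smul, hβ]; rfl
  · intro a ha b hb
    refine ⟨fun h => Subtype.ext (hf _ a b rfl h).symm, fun h => ?_⟩
    have h' : red p Fr M _ b = f ⟨red p Fr M _ a, ha⟩ := (congrArg Subtype.val h).symm
    have hz : Cong p Fr r M σ x (a - α ⟨_, ha⟩) (b - β ⟨_, ha⟩) :=
      Cong.of_red_eq_zero (by rw [map_sub, hα, sub_self]) (by rw [map_sub, hβ, h', sub_self])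
    simpa using hz.add (hcong ⟨_, ha⟩)

theorem IsDelta.unique {Δ Δ' : H0Mod p Fr M (Set.univ : Set X) → H0Mod p Fr M ({x}ᶜ : Set X)}
    (h : IsDelta p Fr r M σ x Δ) (h' : IsDelta p Fr r M σ x Δ') : Δ' = Δ := by
  funext ⟨c, hc⟩
  obtain ⟨a, rfl⟩ := red_surjective _ c
  obtain ⟨b, hb⟩ := red_surjective _ (Δ ⟨_, hc⟩ : UnivMod p Fr M ({x}ᶜ : Set X))
  have hb' : red p Fr M _ b ∈ H0Mod p Fr M {x}ᶜ := hb ▸ (Δ ⟨_, hc⟩).2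
  have e : Δ ⟨_, hc⟩ = ⟨_, hb'⟩ := Subtype.ext hb.symm
  rw [e]
  exact (h' a hc b hb').1 ((h a hc b hb').2 e)

end Derivative

end NormDist

theorem mainTheorem3 {O : Type*} [CommRing O] [IsDomain O]
    {T : Type*} [CommRing T] [Algebra O T] [Module.Finite O T] [Module.IsTorsionFree O T]
    {X : Type*} [LinearOrder X]
    {G : X → Type*} [∀ x, CommGroup (G x)] [∀ x, Fintype (G x)]
    (Fr : X → ∀ x, G x) (p : X → Polynomial T) (r : X → Polynomial O) (M : O) (σ : ∀ x, G x)
    (hM : M ≠ 0)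
    (hMG : ∀ x, M ∣ (Fintype.card (G x) : O))
    (hMp : ∀ x, algebraMap O T M ∣ (p x).eval 1)
    (hσ : ∀ x, ∀ g : G x, g ∈ Subgroup.zpowers (σ x))
    (hγ : ∀ x, ∀ b : NormDist.Univ p Fr ({x}ᶜ : Set X),
      NormDist.gam p Fr r x • b = 0 → b = 0)
    (x : X) :
    (∀ a : NormDist.Univ p Fr (Set.univ : Set X),
      NormDist.red p Fr M _ a ∈ NormDist.H0Mod p Fr M Set.univ →
        ∃! q : NormDist.Univ p Fr (Set.univ : Set X),
          (NormDist.scal M : NormDist.GrpRing G T) • q =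
            (1 - NormDist.grp (Pi.mulSingle x (σ x)) : NormDist.GrpRing G T) • a) ∧
    (∀ b : NormDist.Univ p Fr ({x}ᶜ : Set X),
      NormDist.red p Fr M _ b ∈ NormDist.H0Mod p Fr M {x}ᶜ →
        ∃! q' : NormDist.Univ p Fr ({x}ᶜ : Set X),
          (NormDist.scal M : NormDist.GrpRing G T) • q' = NormDist.gam p Fr r x • b) ∧
    ∃ Δ : NormDist.H0Mod p Fr M (Set.univ : Set X) →ₗ[NormDist.GrpRing G T]
        NormDist.H0Mod p Fr M ({x}ᶜ : Set X),
      NormDist.IsDelta p Fr r M σ x Δ ∧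
      (∀ Δ' : NormDist.H0Mod p Fr M (Set.univ : Set X) →+
          NormDist.H0Mod p Fr M ({x}ᶜ : Set X),
        NormDist.IsDelta p Fr r M σ x Δ' → Δ' = Δ.toAddMonoidHom) ∧
      (∀ s : Finset X, x ∈ s →
        (LinearMap.range (NormDist.H0incl p Fr M (Set.subset_univ (s : Set X)))).map Δ ≤
          LinearMap.range (NormDist.H0incl p Fr M
            (show (s : Set X) \ {x} ⊆ {x}ᶜ from fun _ h => h.2))) := by
  refine ⟨fun a ha => ?_, fun b hb => ?_, ?_⟩
  · obtain ⟨q, hq⟩ := NormDist.exists_scal_smul_eq_one_sub_smul ha (Pi.mulSingle x (σ x))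
    exact ⟨q, hq, fun q₂ h => NormDist.scal_smul_injective hM _ (Eq.trans h hq.symm)⟩
  · obtain ⟨q, hq⟩ := NormDist.exists_scal_smul_eq_gam_smul (r := r) (hMG x) (hMp x) hb
    exact ⟨q, hq, fun q₂ h => NormDist.scal_smul_injective hM _ (Eq.trans h hq.symm)⟩
  · obtain ⟨Δ, hΔ⟩ := NormDist.exists_isDelta hM (hγ x) σ
    refine ⟨Δ, hΔ, fun Δ' h => DFunLike.coe_injective (hΔ.unique h), fun s _ => ?_⟩
    rintro _ ⟨_, ⟨⟨c, hc⟩, rfl⟩, rfl⟩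
    obtain ⟨a, rfl⟩ := NormDist.red_surjective _ c
    have hsub : (s : Set X) \ {x} ⊆ {x}ᶜ := fun _ h => h.2
    -- the derivative can be computed within level `z`, where `γ_x` is injective as well
    obtain ⟨q, q', b, e, e', m, hb⟩ := NormDist.exists_derivative hM subset_rfl (fun h => h.2 rfl)
      (fun b hb => NormDist.incl_injective hsub (by
        rw [map_zero]; exact hγ x _ (by rw [← map_smul, hb, map_zero]))) (σ x) hc
    refine ⟨⟨_, hb⟩, ((hΔ (NormDist.incl p Fr (Set.subset_univ _) a) (NormDist.H0incl p Fr M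
      (Set.subset_univ _) ⟨_, hc⟩).2 (NormDist.incl p Fr hsub b)
      (NormDist.H0incl p Fr M hsub ⟨_, hb⟩).2).1 ⟨NormDist.incl p Fr (Set.subset_univ _) q,
        NormDist.incl p Fr hsub q', ?_, ?_, ?_⟩).symm⟩
    · rw [← map_smul, e, map_smul]
    · rw [← map_smul, e', map_smul]
    · rw [NormDist.sub_incl_mem_idl_iff (NormDist.univ_sdiff_subset x),
        NormDist.special_naturality subset_rfl _ _ hsub, m]
      rfl
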